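/- **Setting.** Let $\{T_n\}_{n\ge0}$ (the access points, APs) be the atoms of a homogeneous Poisson point process $\Phi$ of intensity $\lambda>0$ on $\mathbb R^2$, defined on a probability space $(\Omega,\mathcal A,\mathbb P)$ with a $\mathbb P$-preserving measurable flow $(\theta_x)_{x\in\mathbb R^2}$ such that the marked configuration at $\theta_x\omega$ is the marked configuration at $\omega$ shifted by $-x$. Each AP carries a pair consisting of a tier $J(T_n)\in\{1,\dots,K\}$ and a random field of channel gains $z\mapsto H_n(T_n+z)\in[0,\infty)$, $z\in\mathbb R^2$ (a measurable field). These pairs are i.i.d. over $n$ and independent of the locations; $\mathbb P(J(T_n)=k)=p_k$; and for every displacement $z$, given $J(T_n)=k$, the gain $H_n(T_n+z)$ has the law of a random variable $H_k$ with $H_k>0$ almost surely. (Hence the tiers $\Phi_k=\{T_n: J(T_n)=k\}$ are independent Poisson processes of intensities $\lambda_k:=p_k\lambda$.) An AP of tier $k$ has transmit power $P_k>0$ and path loss exponent $a_k>0$, and $\mathbb E[H_k^{2/a_k}]<\infty$ for all $k$. The power received at $y$ from an AP $T_n$ of tier $k$ is $S_n(y)=P_kH_n(y)\|T_n-y\|^{-a_k}$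 (infinite at $y=T_n$). Under max power association, $y$ is served by the AP $\kappa(y)=\arg\sup_nS_n(y)$; the association cell is $\mathcal C(T_n)=\{y:\kappa(y)=T_n\}=\{y: S_n(y)>S_m(y)\ \forall m\ne n\}$, and $|\mathcal C(T_n)|$ is its area. Let $\mathbb P^o$ be the Palm probability of $\Phi$, i.e. $\mathbb P^o(A)=\frac1{\lambda|B|}\mathbb E\big[\sum_{n:T_n\in B}1_A\circ\theta_{T_n}\big]$ for a Borel set $B$ with $0<|B|<\infty$ (any such $B$ may be used below); under $\mathbb P^o$ there is an AP $T_0=0$ at the origin. Let $\mathbb E^{o,i}$ be the expectation under $\mathbb P^o(\,\cdot\mid J(T_0)=i)$. **Lemma.** For every tier $i$ with $p_i>0$, put $\tilde\lambda_k=\lambda_kP_k^{2/a_k}\mathbb E[H_k^{2/a_k}]$. The mean association area of a typical AP of tier $i$ is $$\mathbb E^{o,i}\big[|\mathcal C(T_0)|\big]=2\pi\int_0^\infty r\,\mathbb E_{H_i}\Big[\exp\Big(-\pi\sum_{k=1}^K\tilde\lambda_k\,r^{2a_i/a_k}(P_iH_i)^{-2/a_k}\Big)\Big]\,dr ,$$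 where the integral on the right is finite. If moreover $a_k=a$ for all $k$, then $$\mathbb E^{o,i}\big[|\mathcal C(T_0)|\big]=\frac{P_i^{2/a}\,\mathbb E[H_i^{2/a}]}{\sum_{k=1}^K\lambda_kP_k^{2/a}\,\mathbb E[H_k^{2/a}]}.$$ -/

import Mathlib

open MeasureTheory ProbabilityTheory Set
open scoped ENNReal NNReal

/-- The Euclidean plane. -/
abbrev Plane : Type := EuclideanSpace ℝ (Fin 2)

/-- The number of indices `n` (an element of `ℕ∞`) for which the random point `T n` falls
into `B`. -/
noncomputable def pointCount {Ω : Type*} (T : ℕ → Ω → Plane) (B : Set Plane) (ω : Ω) : ℕ∞ :=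
  {n : ℕ | T n ω ∈ B}.encard

/-- The random points `T 0, T 1, …` are the atoms of a homogeneous Poisson point process of
intensity `lam` on the plane: numbers of points in Borel sets of finite area are Poisson
distributed, and they are independent for disjoint sets. -/
structure IsPoissonProcess {Ω : Type*} [MeasurableSpace Ω] (P : Measure Ω)
    (T : ℕ → Ω → Plane) (lam : ℝ) : Prop where
  measurable : ∀ n, Measurable (T n)
  count_law : ∀ B : Set Plane, MeasurableSet B → volume B ≠ ∞ → ∀ j : ℕ,
    P {ω | pointCount T B ω = j} =
      ENNReal.ofReal (Real.exp (-(lam * volume.real B)) * (lam * volume.real B) ^ j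
        / (j.factorial : ℝ))
  count_indep : ∀ (l : ℕ) (B : Fin l → Set Plane), (∀ s, MeasurableSet (B s)) →
    (∀ s, volume (B s) ≠ ∞) → Pairwise (fun s t => Disjoint (B s) (B t)) →
    iIndepFun (fun s => pointCount T (B s)) P

/-- A measurable flow of the plane on `Ω` that preserves `P`. -/
structure IsStationaryFlow {Ω : Type*} [MeasurableSpace Ω] (P : Measure Ω)
    (θ : Plane → Ω → Ω) : Prop where
  measurable : Measurable (Function.uncurry θ)
  zero : ∀ ω, θ 0 ω = ω
  add : ∀ x y ω, θ (x + y) ω = θ x (θ y ω)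
  invariant : ∀ x, MeasurePreserving (θ x) P P

/-- The data of a random `K`-tier network on the sample space `Ω`. -/
structure HetNet (Ω : Type*) (M : Type*) (K : ℕ) where
  /-- the flow of shifts on the sample space -/
  θ : Plane → Ω → Ω
  /-- the locations of the access points -/
  T : ℕ → Ω → Plane
  /-- the tiers of the access points -/
  tier : ℕ → Ω → Fin K
  /-- the fading marks of the access points; a mark encodes a whole random field -/
  mark : ℕ → Ω → M
  /-- `fading m z` is the channel gain of an access point with mark `m` at displacement `z`
  from the access point -/
  fading : M → Plane → ℝ≥0
  /-- the transmit power of each tier -/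
  pow : Fin K → ℝ≥0
  /-- the path loss exponent of each tier -/
  ple : Fin K → ℝ

namespace HetNet

variable {Ω M : Type*} {K : ℕ}

/-- The channel gain `H_n(y)` from access point `n` to the location `y`. -/
def gain (N : HetNet Ω M K) (n : ℕ) (ω : Ω) (y : Plane) : ℝ≥0 :=
  N.fading (N.mark n ω) (y - N.T n ω)

/-- The power `S_n(y) = P(n) H_n(y) ‖T_n - y‖ ^ (-a(n))` received at `y` from access point `n`;
it is infinite at `y = T_n` (for a positive gain). -/
noncomputable def received (N : HetNet Ω M K) (n : ℕ) (ω : Ω) (y : Plane) : ℝ≥0∞ :=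
  (N.pow (N.tier n ω) : ℝ≥0∞) * (N.gain n ω y : ℝ≥0∞)
    * (edist (N.T n ω) y) ^ (-(N.ple (N.tier n ω)))

/-- Max power association, `κ(y) = x`: the access point from which the largest power is received
at `y` is well defined, and it lies at `x`. -/
def Serves (N : HetNet Ω M K) (ω : Ω) (x y : Plane) : Prop :=
  ∃ n, N.T n ω = x ∧ ∀ m, m ≠ n → N.received m ω y < N.received n ω y

/-- The association cell of (the access point at) `x`. -/
def cell (N : HetNet Ω M K) (ω : Ω) (x : Plane) : Set Plane :=
  {y | N.Serves ω x y}

/-- The locations together with their marks are carried along by the flow: the marked point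
configuration of `θ_x ω` is that of `ω` shifted by `-x` (up to the numbering of the points). -/
def IsCompatible (N : HetNet Ω M K) : Prop :=
  ∀ (x : Plane) (ω : Ω), ∃ σ : Equiv.Perm ℕ, ∀ n,
    N.T (σ n) (N.θ x ω) = N.T n ω - x ∧ N.tier (σ n) (N.θ x ω) = N.tier n ω ∧
      N.mark (σ n) (N.θ x ω) = N.mark n ω

variable [MeasurableSpace Ω] [MeasurableSpace M]

/-- The Palm probability of the point process of all access points, of intensity `lam`:
`P°(A) = (lam |B|)⁻¹ E ∑_{n : T_n ∈ B} 1_A(θ_{T_n} ω)`. -/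
noncomputable def palm (N : HetNet Ω M K) (P : Measure Ω) (lam : ℝ) (B : Set Plane) :
    Measure Ω :=
  (ENNReal.ofReal lam * volume B)⁻¹ •
    Measure.sum (fun n : ℕ => (P.restrict {ω | N.T n ω ∈ B}).map (fun ω => N.θ (N.T n ω) ω))

/-- The event that there is an access point of tier `i` at the origin. -/
def tierAtOrigin (N : HetNet Ω M K) (i : Fin K) : Set Ω :=
  {ω | ∃ n, N.T n ω = 0 ∧ N.tier n ω = i}

/-- The mean association area of a typical access point of tier `i`: the mean area of the cell
of the access point at the origin, under the Palm probability conditioned on the tier of that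
access point being `i`. -/
noncomputable def meanCellArea (N : HetNet Ω M K) (P : Measure Ω) (lam : ℝ) (B : Set Plane)
    (i : Fin K) : ℝ≥0∞ :=
  ∫⁻ ω, volume (N.cell ω 0) ∂(ProbabilityTheory.cond (N.palm P lam B) (N.tierAtOrigin i))

/-- The probabilistic assumptions: the access points form a Poisson process of intensity `lam`,
compatible with a stationary flow; each access point carries a pair (tier, fading mark), these
pairs are i.i.d. and independent of the locations; a point is of tier `k` with probability `p k`
and its fading mark then has the law `ν k`, under which the gain at every displacement has the
law `γ k`. -/
structure IsPoissonNetwork (N : HetNet Ω M K) (P : Measure Ω) (lam : ℝ) (p : Fin K → ℝ)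
    (ν : Fin K → Measure M) (γ : Fin K → Measure ℝ≥0) : Prop where
  flow : IsStationaryFlow P N.θ
  compatible : N.IsCompatible
  poisson : IsPoissonProcess P N.T lam
  measurable_tier : ∀ n, Measurable (N.tier n)
  measurable_mark : ∀ n, Measurable (N.mark n)
  measurable_fading : Measurable (Function.uncurry N.fading)
  marks_indep : iIndepFun (fun n ω => (N.tier n ω, N.mark n ω)) P
  marks_indep_points :
    IndepFun (fun ω n => N.T n ω) (fun ω n => (N.tier n ω, N.mark n ω)) P
  mark_law : ∀ (n : ℕ) (k : Fin K) (A : Set M), MeasurableSet A →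
    P {ω | N.tier n ω = k ∧ N.mark n ω ∈ A} = ENNReal.ofReal (p k) * ν k A
  gain_law : ∀ (k : Fin K) (z : Plane), (ν k).map (fun m => N.fading m z) = γ k

end HetNet

/-- The moment `E[H ^ s]` of a gain `H` with law `γ`. -/
noncomputable def gainMoment (γ : Measure ℝ≥0) (s : ℝ) : ℝ :=
  ∫ h, (h : ℝ) ^ s ∂γ

/-! Fix a location y. By the definition of the Palm measure and compatibility with the flow, the
mean cell area of tier i is (p_i λ|B|)⁻¹ times the integral over y of the expected number of tier-i
points in B that serve y. The task is thus to count, for a fixed y, the marked points that strictly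
maximize the score "power received at y".

The points together with their (tier, mark) pairs behave like a Poisson process of intensity Λ = λ
dx ⊗ `markLaw`. The Mecke formula would give the expected number of strict maximizers in A as ∫_A
exp(-Λ{S ≥ S(x)}) dΛ(x). Here this is `tsum_measure_strictMax`, derived from the generating
functional alone. The functional is built from independent Poisson counts on level sets
(`lintegral_infProd_simpleFunc`), then extended by monotone limits and by averaging over marks.
Differentiating it at 0 gives the probability that a set D contains exactly one point and that this
point lies in C (`measure_only`). Discretizing the score turns a strict maximum into such one-point
events.

For received power, Λ{S ≥ s} = π ∑ λ̃_k s^(-2/a_k) by Fubini: with the gain frozen, the set of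
locations is a disc, whose area brings in the moment of order 2/a_k (`intensity_score_ge`). Only the
one-dimensional law of the gain matters, since each point is seen from y at a single displacement.
At s = P_i h‖y-x‖^(-a_i) the exponential is `coverage`. It depends only on y - x, so integrating
over y first cancels λ, p_i and |B| (`meanCellArea_eq_lintegral_coverage`). Polar coordinates give
the formula; bounding the sum below by its k = i term leaves a Gaussian and proves finiteness; with
equal exponents the whole sum is Gaussian and the integral is explicit.

Cells are attached to locations, so the points must be almost surely distinct; this too is extracted
from the one-point formula (`ae_injective`). -/

/-! ### Generating function and mean of Poisson counts. -/

section PoissonCounts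

open Filter Topology

lemma toENNReal_pointCount {Ω : Type*} (T : ℕ → Ω → Plane) (B : Set Plane) (ω : Ω) :
    ((pointCount T B ω : ℕ∞) : ℝ≥0∞) = ∑' n, B.indicator (fun _ => (1 : ℝ≥0∞)) (T n ω) := by
  rw [pointCount, ← ENNReal.tsum_set_one, tsum_subtype {n : ℕ | T n ω ∈ B} (fun _ => (1 : ℝ≥0∞))]
  rfl

variable {Ω : Type*} [MeasurableSpace Ω] {P : Measure Ω} {T : ℕ → Ω → Plane} {lam : ℝ}

lemma measurable_pointCount (hT : ∀ n, Measurable (T n)) {B : Set Plane} (hB : MeasurableSet B) :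
    Measurable (pointCount T B) := by
  have h : Measurable fun ω => ((pointCount T B ω : ℕ∞) : ℝ≥0∞) := by
    simp_rw [toENNReal_pointCount]
    exact Measurable.tsum fun n => (measurable_const.indicator hB).comp (hT n)
  rw [ENat.measurable_iff]
  intro n
  have := h (measurableSet_singleton (n : ℝ≥0∞))
  convert this using 1
  ext ω
  simp only [mem_preimage, mem_singleton_iff]
  rw [← ENat.toENNReal_coe, ENat.toENNReal_inj]

/-- `exp (-x)` for a finite extended nonnegative real `x`. -/
noncomputable def expNeg (x : ℝ≥0∞) : ℝ≥0∞ := ENNReal.ofReal (Real.exp (-x.toReal))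

lemma expNeg_sum {ι : Type*} (s : Finset ι) (f : ι → ℝ≥0∞) (hf : ∀ i ∈ s, f i ≠ ∞) :
    expNeg (∑ i ∈ s, f i) = ∏ i ∈ s, expNeg (f i) := by
  simp only [expNeg]
  rw [ENNReal.toReal_sum hf, ← Finset.sum_neg_distrib, Real.exp_sum,
    ENNReal.ofReal_prod_of_nonneg fun _ _ => (Real.exp_pos _).le]

/-- Finiteness of y is essential: `toReal` sends ∞ to 0, so `expNeg ∞ = 1`. This is why finite
intensities are tracked throughout. -/
lemma expNeg_anti {x y : ℝ≥0∞} (h : x ≤ y) (hy : y ≠ ∞) : expNeg y ≤ expNeg x := by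
  unfold expNeg
  gcongr

lemma measurable_expNeg : Measurable expNeg := by unfold expNeg; fun_prop

lemma tendsto_expNeg {ι : Type*} {l : Filter ι} {f : ι → ℝ≥0∞} {x : ℝ≥0∞} (hx : x ≠ ∞)
    (h : Tendsto f l (𝓝 x)) : Tendsto (fun i => expNeg (f i)) l (𝓝 (expNeg x)) := by
  refine ENNReal.tendsto_ofReal (Real.continuous_exp.continuousAt.tendsto.comp ?_)
  exact ((ENNReal.tendsto_toReal hx).comp h).neg

lemma hasSum_poisson_pgf (x c : ℝ) :
    HasSum (fun j : ℕ => c ^ j * (Real.exp (-x) * x ^ j / (j.factorial : ℝ)))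
      (Real.exp (-(x * (1 - c)))) := by
  have h := (NormedSpace.expSeries_div_hasSum_exp (c * x)).mul_left (Real.exp (-x))
  rw [← Real.exp_eq_exp_ℝ, ← Real.exp_add] at h
  have h1 : -x + c * x = -(x * (1 - c)) := by ring
  rw [h1] at h
  refine (congrArg (HasSum · _) (funext fun j => ?_)).mpr h
  rw [mul_pow]; ring

lemma hasSum_poisson_mean (x : ℝ) :
    HasSum (fun j : ℕ => (j : ℝ) * (Real.exp (-x) * x ^ j / (j.factorial : ℝ))) x := by
  -- The term j = 0 vanishes, and after the shift j/j! becomes 1/(j-1)!, so the exponential series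
  -- reappears.
  rw [← hasSum_nat_add_iff' 1]
  have h := (hasSum_poisson_pgf x 1).mul_left x
  simp only [one_pow, one_mul, sub_self, mul_zero, neg_zero, Real.exp_zero, mul_one] at h
  simp only [Finset.range_one, Finset.sum_singleton, Nat.cast_zero, zero_mul, sub_zero]
  refine (congrArg (HasSum · _) (funext fun j => ?_)).mpr h
  rw [Nat.factorial_succ]
  push_cast
  field_simp
  ring

lemma ENNReal.tsum_ofReal_of_hasSum {f : ℕ → ℝ} {a : ℝ} (hf : ∀ n, 0 ≤ f n) (h : HasSum f a) :
    ∑' n, ENNReal.ofReal (f n) = ENNReal.ofReal a := by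
  rw [← ENNReal.ofReal_tsum_of_nonneg hf h.summable, h.tsum_eq]

namespace IsPoissonProcess

/-- The Poisson weights over finite j already sum to 1, which leaves no mass for an infinite count.
-/
lemma ae_pointCount_ne_top [IsProbabilityMeasure P] (h : IsPoissonProcess P T lam) (hlam : 0 < lam)
    {B : Set Plane} (hB : MeasurableSet B) (hB' : volume B ≠ ∞) :
    ∀ᵐ ω ∂P, pointCount T B ω ≠ ⊤ := by
  have hm := measurable_pointCount h.measurable hB
  have hU : {ω | pointCount T B ω ≠ ⊤} = ⋃ j : ℕ, {ω | pointCount T B ω = j} := by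
    ext ω
    simp only [mem_ofPred_eq, mem_iUnion, ENat.ne_top_iff_exists, eq_comm]
  have h1 : P {ω | pointCount T B ω ≠ ⊤} = 1 := by
    rw [hU, measure_iUnion]
    · simp_rw [h.count_law B hB hB']
      have := hasSum_poisson_pgf (lam * volume.real B) 1
      simp only [one_pow, one_mul, sub_self, mul_zero, neg_zero, Real.exp_zero] at this
      rw [ENNReal.tsum_ofReal_of_hasSum _ this, ENNReal.ofReal_one]
      intro n
      positivity
    · intro i j hij
      refine Set.disjoint_left.2 fun ω (h1 : _ = _) (h2 : _ = _) => hij ?_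
      rw [h1] at h2
      exact_mod_cast h2
    · intro j
      exact hm (measurableSet_singleton _)
  exact (prob_compl_eq_zero_iff (hm (measurableSet_singleton ⊤).compl)).2 h1

lemma lintegral_comp_pointCount [IsProbabilityMeasure P] (h : IsPoissonProcess P T lam)
    (hlam : 0 < lam) {B : Set Plane} (hB : MeasurableSet B) (hB' : volume B ≠ ∞) (g : ℕ → ℝ≥0∞) :
    ∫⁻ ω, g (pointCount T B ω).toNat ∂P = ∑' j, g j * ENNReal.ofReal
      (Real.exp (-(lam * volume.real B)) * (lam * volume.real B) ^ j / (j.factorial : ℝ)) := by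
  have hm := measurable_pointCount h.measurable hB
  have hm' : Measurable fun ω => (pointCount T B ω).toNat :=
    (measurable_from_top (f := ENat.toNat)).comp hm
  rw [← lintegral_map (f := g) measurable_from_top hm', lintegral_countable']
  congr 1 with j
  congr 1
  rw [Measure.map_apply hm' (measurableSet_singleton _), ← h.count_law B hB hB']
  apply measure_congr
  filter_upwards [h.ae_pointCount_ne_top hlam hB hB'] with ω hω
  refine propext ?_
  change (pointCount T B ω).toNat = j ↔ pointCount T B ω = j
  lift pointCount T B ω to ℕ using hω with k
  simp

lemma lintegral_pow_pointCount [IsProbabilityMeasure P] (h : IsPoissonProcess P T lam)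
    (hlam : 0 < lam) {B : Set Plane} (hB : MeasurableSet B) (hB' : volume B ≠ ∞) {c : ℝ≥0∞}
    (hc : c ≤ 1) :
    ∫⁻ ω, (1 - c) ^ (pointCount T B ω).toNat ∂P = expNeg (c * (ENNReal.ofReal lam * volume B)) := by
  have hc' : c ≠ ∞ := ne_top_of_le_ne_top ENNReal.one_ne_top hc
  lift c to ℝ≥0 using hc'
  have hc1 : (c : ℝ) ≤ 1 := by exact_mod_cast hc
  rw [h.lintegral_comp_pointCount hlam hB hB' (fun j => (1 - (c : ℝ≥0∞)) ^ j)]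
  have h1 : (1 : ℝ≥0∞) - c = ENNReal.ofReal (1 - c) := by
    rw [ENNReal.ofReal_sub 1 (q := (c : ℝ)) c.2, ENNReal.ofReal_one, ENNReal.ofReal_coe_nnreal]
  have h0 : 0 ≤ 1 - (c : ℝ) := by linarith
  simp_rw [h1, ← ENNReal.ofReal_pow h0, ← ENNReal.ofReal_mul (pow_nonneg h0 _)]
  rw [ENNReal.tsum_ofReal_of_hasSum _ (hasSum_poisson_pgf _ _)]
  · unfold expNeg
    rw [ENNReal.toReal_mul, ENNReal.toReal_mul, ENNReal.toReal_ofReal hlam.le, measureReal_def,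
      ENNReal.coe_toReal]
    congr 3; ring
  · intro n
    have := pow_nonneg h0 n
    positivity

lemma tsum_measure_mem [IsProbabilityMeasure P] (h : IsPoissonProcess P T lam)
    (hlam : 0 < lam) {B : Set Plane} (hB : MeasurableSet B) (hB' : volume B ≠ ∞) :
    ∑' n, P (T n ⁻¹' B) = ENNReal.ofReal lam * volume B := by
  have h1 : ∑' n, P (T n ⁻¹' B) = ∫⁻ ω, ((pointCount T B ω : ℕ∞) : ℝ≥0∞) ∂P := by
    simp_rw [toENNReal_pointCount]
    have hm (n : ℕ) : AEMeasurable (fun ω => B.indicator (fun _ => (1 : ℝ≥0∞)) (T n ω)) P :=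
      ((measurable_const.indicator hB).comp (h.measurable n)).aemeasurable
    rw [lintegral_tsum hm]
    congr 1 with n
    rw [← lintegral_indicator_one (h.measurable n hB)]
    rfl
  have h2 : ∫⁻ ω, ((pointCount T B ω : ℕ∞) : ℝ≥0∞) ∂P
      = ∫⁻ ω, (((pointCount T B ω).toNat : ℕ) : ℝ≥0∞) ∂P := by
    refine lintegral_congr_ae ?_
    filter_upwards [h.ae_pointCount_ne_top hlam hB hB'] with ω hω
    lift pointCount T B ω to ℕ using hω with k
    simp
  rw [h1, h2, h.lintegral_comp_pointCount hlam hB hB' (fun j => (j : ℝ≥0∞))]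
  simp_rw [← ENNReal.ofReal_natCast, ← ENNReal.ofReal_mul (Nat.cast_nonneg _)]
  rw [ENNReal.tsum_ofReal_of_hasSum _ (hasSum_poisson_mean _), ENNReal.ofReal_mul hlam.le,
    ofReal_measureReal hB']
  intro n
  positivity

/-- Campbell's formula: the intensity measure is a multiple of the area. -/
lemma sum_map_eq [IsProbabilityMeasure P] (h : IsPoissonProcess P T lam) (hlam : 0 < lam) :
    Measure.sum (fun n => P.map (T n)) = ENNReal.ofReal lam • (volume : Measure Plane) := by
  have key : ∀ s : Set Plane, MeasurableSet s → volume s ≠ ∞ →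
      Measure.sum (fun n => P.map (T n)) s = (ENNReal.ofReal lam • (volume : Measure Plane)) s := by
    intro s hs hs'
    rw [Measure.sum_apply _ hs, Measure.smul_apply, smul_eq_mul, ← h.tsum_measure_mem hlam hs hs']
    congr 1 with n
    rw [Measure.map_apply (h.measurable n) hs]
  ext s hs
  -- The count law speaks only of sets of finite area; a general set is exhausted by such sets.
  have hU : s = ⋃ n, s ∩ spanningSets (volume : Measure Plane) n := by
    rw [← inter_iUnion, iUnion_spanningSets, inter_univ]
  have hmono : Monotone fun n => s ∩ spanningSets (volume : Measure Plane) n :=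
    fun a b hab => inter_subset_inter_right _ (monotone_spanningSets _ hab)
  rw [hU, hmono.measure_iUnion, hmono.measure_iUnion]
  congr 1 with n
  refine key _ (hs.inter (measurableSet_spanningSets _ _)) ?_
  exact ne_top_of_le_ne_top (measure_spanningSets_lt_top _ n).ne (measure_mono inter_subset_right)

end IsPoissonProcess

end PoissonCounts

/-! ### The generating functional of the unmarked process. -/

section ProductFunctional

open Filter Topology

/-- The infinite product of a sequence of factors in `[0, 1]`. -/
noncomputable def infProd (f : ℕ → ℝ≥0∞) : ℝ≥0∞ := ⨅ N : ℕ, ∏ n ∈ Finset.range N, f n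

lemma antitone_partialProd {f : ℕ → ℝ≥0∞} (hf : ∀ n, f n ≤ 1) :
    Antitone fun N : ℕ => ∏ n ∈ Finset.range N, f n :=
  antitone_nat_of_succ_le fun _ => by
    rw [Finset.prod_range_succ]
    exact mul_le_of_le_one_right' (hf _)

lemma tendsto_infProd {f : ℕ → ℝ≥0∞} (hf : ∀ n, f n ≤ 1) :
    Tendsto (fun N : ℕ => ∏ n ∈ Finset.range N, f n) atTop (𝓝 (infProd f)) :=
  tendsto_atTop_iInf (antitone_partialProd hf)

lemma infProd_le (f : ℕ → ℝ≥0∞) (N : ℕ) : infProd f ≤ ∏ n ∈ Finset.range N, f n := iInf_le _ N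

lemma infProd_le_one (f : ℕ → ℝ≥0∞) : infProd f ≤ 1 := by
  simpa using infProd_le f 0

lemma Measurable.infProd {Ω : Type*} [MeasurableSpace Ω] {f : ℕ → Ω → ℝ≥0∞}
    (hf : ∀ n, Measurable (f n)) : Measurable fun ω => infProd fun n => f n ω :=
  Measurable.iInf fun _ => Finset.measurable_prod _ fun n _ => hf n

/-- A finite index set is bounded, so the partial products become stationary. -/
lemma eventually_prod_pow_count {s : Set ℕ} [DecidablePred (· ∈ s)] (hs : s.encard ≠ ⊤)
    (c : ℝ≥0∞) :
    ∀ᶠ N in atTop, ∏ n ∈ Finset.range N, (if n ∈ s then c else 1) = c ^ s.encard.toNat := by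
  have hfin : s.Finite := encard_ne_top_iff.1 hs
  obtain ⟨M, hM⟩ := hfin.bddAbove
  filter_upwards [eventually_gt_atTop M] with N hN
  rw [Finset.prod_ite, Finset.prod_const_one, mul_one, Finset.prod_const]
  congr 1
  rw [← Set.ncard_def, ← Set.ncard_coe_finset]
  congr 1
  ext n
  simp only [Finset.coe_filter, Finset.mem_range, mem_ofPred_eq, and_iff_right_iff_imp]
  exact fun hn => (hM hn).trans_lt hN

variable {Ω : Type*} [MeasurableSpace Ω] {P : Measure Ω} {T : ℕ → Ω → Plane} {lam : ℝ}

namespace IsPoissonProcess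

lemma iIndepFun_pointCount (h : IsPoissonProcess P T lam) {ι : Type*} [Fintype ι]
    {B : ι → Set Plane} (hB : ∀ s, MeasurableSet (B s)) (hB' : ∀ s, volume (B s) ≠ ∞)
    (hd : Pairwise fun s t => Disjoint (B s) (B t)) :
    iIndepFun (fun s => pointCount T (B s)) P := by
  let e := Fintype.equivFin ι
  have := h.count_indep (Fintype.card ι) (fun s => B (e.symm s)) (fun s => hB _) (fun s => hB' _)
    (fun s t hst => hd (e.symm.injective.ne hst))
  have h2 := this.precomp e.injective
  simpa [Function.comp_def] using h2

/-- Grouping the points by the value of w turns the product into a finite product of powers (1 -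
c)^(count of the level set of c). The level sets are disjoint, so the counts are independent and
each factor is a Poisson generating function. -/
lemma lintegral_infProd_simpleFunc [IsProbabilityMeasure P] (h : IsPoissonProcess P T lam)
    (hlam : 0 < lam) (w : SimpleFunc Plane ℝ≥0∞) (hw : ∀ x, w x ≤ 1)
    (hw' : ∀ c, c ≠ 0 → volume (w ⁻¹' {c}) ≠ ∞) :
    ∫⁻ ω, infProd (fun n => 1 - w (T n ω)) ∂P
      = expNeg (∫⁻ x, w x ∂(ENNReal.ofReal lam • (volume : Measure Plane))) := by
  classical
  -- The value 0 is dropped: its level set may have infinite area, and it only contributes factors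
  -- 1.
  let s := w.range.filter (· ≠ 0)
  have hs0 (c : s) : (c : ℝ≥0∞) ≠ 0 := (Finset.mem_filter.1 c.2).2
  have hs1 (c : s) : (c : ℝ≥0∞) ≤ 1 := by
    obtain ⟨x, hx⟩ := SimpleFunc.mem_range.1 (Finset.mem_filter.1 c.2).1
    exact hx ▸ hw x
  let B : s → Set Plane := fun c => w ⁻¹' {(c : ℝ≥0∞)}
  have hB (c : s) : MeasurableSet (B c) := w.measurableSet_fiber _
  have hB' (c : s) : volume (B c) ≠ ∞ := hw' _ (hs0 c)
  have hd : Pairwise fun c d => Disjoint (B c) (B d) := fun c d hcd =>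
    Set.disjoint_left.2 fun x (hx : w x = c) (hy : w x = d) => hcd (Subtype.ext (hx ▸ hy))
  have hind := h.iIndepFun_pointCount hB hB' hd
  have hfac (x : Plane) : 1 - w x = ∏ c : s, if x ∈ B c then 1 - (c : ℝ≥0∞) else 1 := by
    by_cases hx : w x = 0
    · rw [Finset.prod_eq_one, hx, tsub_zero]
      intro c _
      rw [if_neg]
      exact fun hc : w x = c => hs0 c (hc ▸ hx)
    · have hmem : w x ∈ s := Finset.mem_filter.2 ⟨SimpleFunc.mem_range_self _ _, hx⟩
      rw [Finset.prod_eq_single ⟨w x, hmem⟩]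
      · rw [if_pos]
        exact rfl
      · intro c _ hc
        rw [if_neg]
        exact fun hc' : w x = c => hc (Subtype.ext hc'.symm)
      · simp
  have hprod : ∀ᵐ ω ∂P, infProd (fun n => 1 - w (T n ω))
      = ∏ c : s, (1 - (c : ℝ≥0∞)) ^ (pointCount T (B c) ω).toNat := by
    have := ae_all_iff.2 fun c : s => h.ae_pointCount_ne_top hlam (hB c) (hB' c)
    filter_upwards [this] with ω hω
    refine tendsto_nhds_unique (tendsto_infProd fun n => tsub_le_self) ?_
    refine tendsto_const_nhds.congr' ?_
    have hev : ∀ᶠ N in atTop, ∀ c : s, ∏ n ∈ Finset.range N,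
        (if n ∈ {n : ℕ | T n ω ∈ B c} then 1 - (c : ℝ≥0∞) else 1)
          = (1 - (c : ℝ≥0∞)) ^ (pointCount T (B c) ω).toNat :=
      eventually_all.2 fun c => eventually_prod_pow_count (hω c) _
    filter_upwards [hev] with N hN
    simp_rw [hfac]
    rw [Finset.prod_comm]
    exact Finset.prod_congr rfl fun c _ => (hN c).symm
  rw [lintegral_congr_ae hprod]
  have hg (c : s) : Measurable fun k : ℕ∞ => (1 - (c : ℝ≥0∞)) ^ k.toNat := measurable_from_top
  rw [lintegral_prod_eq_prod_lintegral_of_indepFun Finset.univ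
    (fun (c : s) ω => (1 - (c : ℝ≥0∞)) ^ (pointCount T (B c) ω).toNat)
    (hind.comp (fun c k => (1 - (c : ℝ≥0∞)) ^ k.toNat) hg)
    (fun c => (hg c).comp (measurable_pointCount h.measurable (hB c)))]
  have hterm (c : s) : ∫⁻ ω, (1 - (c : ℝ≥0∞)) ^ (pointCount T (B c) ω).toNat ∂P
      = expNeg (c * (ENNReal.ofReal lam * volume (B c))) :=
    h.lintegral_pow_pointCount hlam (hB c) (hB' c) (hs1 c)
  simp_rw [hterm]
  rw [← expNeg_sum]
  · congr 1
    rw [SimpleFunc.lintegral_eq_lintegral, SimpleFunc.lintegral,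
      Finset.sum_coe_sort s (fun c => c * (ENNReal.ofReal lam * volume (w ⁻¹' {c}))),
      Finset.sum_filter_of_ne]
    · rfl
    · rintro c - hc rfl
      simp at hc
  · intro c _
    exact ENNReal.mul_ne_top (ne_top_of_le_ne_top ENNReal.one_ne_top (hs1 c))
      (ENNReal.mul_ne_top ENNReal.ofReal_ne_top (hB' c))

/-- The generating functional of a Poisson process. -/
lemma lintegral_infProd [IsProbabilityMeasure P] (h : IsPoissonProcess P T lam)
    (hlam : 0 < lam) {w : Plane → ℝ≥0∞} (hm : Measurable w) (hw : ∀ x, w x ≤ 1)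
    (hfin : ∫⁻ x, w x ∂(ENNReal.ofReal lam • (volume : Measure Plane)) ≠ ∞) :
    ∫⁻ ω, infProd (fun n => 1 - w (T n ω)) ∂P
      = expNeg (∫⁻ x, w x ∂(ENNReal.ofReal lam • (volume : Measure Plane))) := by
  -- Cutting off to a ball gives every nonzero level set finite area while keeping the approximation
  -- increasing.
  let W : ℕ → SimpleFunc Plane ℝ≥0∞ := fun d =>
    (SimpleFunc.eapprox w d).restrict (Metric.closedBall 0 d)
  have hW (d : ℕ) (x : Plane) :
      W d x = (Metric.closedBall (0 : Plane) d).indicator (SimpleFunc.eapprox w d) x :=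
    SimpleFunc.restrict_apply _ Metric.isClosed_closedBall.measurableSet _
  have hmono (x : Plane) : Monotone fun d => W d x := by
    intro d e hde
    simp only [hW]
    refine (indicator_le_indicator_of_subset
      (Metric.closedBall_subset_closedBall (Nat.cast_le.2 hde)) (fun _ => zero_le) x).trans ?_
    exact indicator_le_indicator (SimpleFunc.monotone_eapprox w hde x)
  have htend (x : Plane) : Tendsto (fun d => W d x) atTop (𝓝 (w x)) := by
    refine (SimpleFunc.tendsto_eapprox hm x).congr' ?_
    filter_upwards [eventually_ge_atTop ⌈‖x‖⌉₊] with d hd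
    rw [hW, indicator_of_mem]
    simpa using Nat.ceil_le.1 hd
  have hle (d : ℕ) (x : Plane) : W d x ≤ w x := (hmono x).ge_of_tendsto (htend x) d
  have hsimple (d : ℕ) := h.lintegral_infProd_simpleFunc hlam (W d)
    (fun x => (hle d x).trans (hw x)) (fun c hc => by
      refine ne_top_of_le_ne_top (measure_closedBall_lt_top (x := (0 : Plane)) (r := d)).ne
        (measure_mono fun x hx => ?_)
      by_contra hx'
      refine hc ?_
      rw [← show W d x = c from hx, hW, indicator_of_notMem hx'])
  have hR : Tendsto (fun d => expNeg (∫⁻ x, W d x ∂(ENNReal.ofReal lam • (volume : Measure Plane))))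
      atTop (𝓝 (expNeg (∫⁻ x, w x ∂(ENNReal.ofReal lam • (volume : Measure Plane))))) :=
    tendsto_expNeg hfin (lintegral_tendsto_of_tendsto_of_monotone
      (fun d => (W d).measurable.aemeasurable) (ae_of_all _ hmono) (ae_of_all _ htend))
  refine tendsto_nhds_unique ?_ hR
  simp_rw [← hsimple]
  refine tendsto_lintegral_of_dominated_convergence (fun _ => 1) ?_ ?_ (by simp) ?_
  · intro d
    exact Measurable.infProd fun n => (measurable_const.sub (W d).measurable).comp (h.measurable n)
  · intro d
    exact ae_of_all _ fun ω => infProd_le_one _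
  · refine ae_of_all _ fun ω => ?_
    have hanti (N : ℕ) : Antitone fun d => ∏ n ∈ Finset.range N, (1 - W d (T n ω)) :=
      fun d e hde => Finset.prod_le_prod' fun n _ => tsub_le_tsub_left (hmono _ hde) _
    have hlim (N : ℕ) : ⨅ d, ∏ n ∈ Finset.range N, (1 - W d (T n ω))
        = ∏ n ∈ Finset.range N, (1 - w (T n ω)) := by
      refine tendsto_nhds_unique (tendsto_atTop_iInf (hanti N)) ?_
      refine ENNReal.tendsto_finsetProd_of_ne_top _ (fun n _ => ?_) (fun n _ => ?_)
      · exact ENNReal.Tendsto.sub tendsto_const_nhds (htend _) (Or.inl ENNReal.one_ne_top)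
      · exact ne_top_of_le_ne_top ENNReal.one_ne_top tsub_le_self
    -- The limit in d and the infinite product are both infima of decreasing families, so they
    -- commute.
    have : infProd (fun n => 1 - w (T n ω)) = ⨅ d, infProd fun n => 1 - W d (T n ω) := by
      unfold infProd
      rw [iInf_comm]
      simp_rw [hlim]
    rw [this]
    exact tendsto_atTop_iInf fun d e hde => iInf_mono fun N => hanti N hde

end IsPoissonProcess

end ProductFunctional

/-! ### The generating functional with i.i.d. marks. -/

section MarkedPoisson

open Filter Topology

/-- The points `T n` of a Poisson process of intensity `lam` carry i.i.d. marks `Z n` of law `μ`,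
independent of the points. -/
structure IsMarkedPoisson {Ω M : Type*} [MeasurableSpace Ω] [MeasurableSpace M] (P : Measure Ω)
    (T : ℕ → Ω → Plane) (Z : ℕ → Ω → M) (lam : ℝ) (μ : Measure M) : Prop where
  poisson : IsPoissonProcess P T lam
  measurable_mark : ∀ n, Measurable (Z n)
  indep : iIndepFun Z P
  indep_points : IndepFun (fun ω n => T n ω) (fun ω n => Z n ω) P
  law : ∀ n, P.map (Z n) = μ

variable {Ω M : Type*} [MeasurableSpace Ω] [MeasurableSpace M] {P : Measure Ω}
  {T : ℕ → Ω → Plane} {Z : ℕ → Ω → M} {lam : ℝ} {μ : Measure M}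

lemma IsMarkedPoisson.measurable_pair (h : IsMarkedPoisson P T Z lam μ) (n : ℕ) :
    Measurable fun ω => (T n ω, Z n ω) :=
  (h.poisson.measurable n).prodMk (h.measurable_mark n)

variable [IsProbabilityMeasure P]

lemma ProbabilityTheory.IndepFun.lintegral_prodMk {α β : Type*} [MeasurableSpace α]
    [MeasurableSpace β] {X : Ω → α} {Y : Ω → β} (hX : Measurable X) (hY : Measurable Y)
    (h : IndepFun X Y P) {F : α × β → ℝ≥0∞} (hF : Measurable F) :
    ∫⁻ ω, F (X ω, Y ω) ∂P = ∫⁻ ω, ∫⁻ ω', F (X ω, Y ω') ∂P ∂P := by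
  have := Measure.isProbabilityMeasure_map (μ := P) hX.aemeasurable
  have := Measure.isProbabilityMeasure_map (μ := P) hY.aemeasurable
  rw [← lintegral_map hF (hX.prodMk hY),
    (indepFun_iff_map_prod_eq_prod_map_map hX.aemeasurable hY.aemeasurable).1 h,
    lintegral_prod _ hF.aemeasurable, lintegral_map hF.lintegral_prod_right' hX]
  refine lintegral_congr fun ω => ?_
  exact lintegral_map (hF.comp measurable_prodMk_left) hY

namespace IsMarkedPoisson

lemma isProbabilityMeasure (h : IsMarkedPoisson P T Z lam μ) : IsProbabilityMeasure μ := by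
  rw [← h.law 0]
  exact Measure.isProbabilityMeasure_map (h.measurable_mark 0).aemeasurable

lemma lintegral_pair (h : IsMarkedPoisson P T Z lam μ) (n : ℕ) {f : Plane × M → ℝ≥0∞}
    (hf : Measurable f) :
    ∫⁻ ω, f (T n ω, Z n ω) ∂P = ∫⁻ x, ∫⁻ z, f (x, z) ∂μ ∂(P.map (T n)) := by
  have := h.isProbabilityMeasure
  have hind : IndepFun (T n) (Z n) P :=
    h.indep_points.comp (measurable_pi_apply n) (measurable_pi_apply n)
  rw [hind.lintegral_prodMk (h.poisson.measurable n) (h.measurable_mark n) hf,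
    lintegral_map hf.lintegral_prod_right' (h.poisson.measurable n)]
  refine lintegral_congr fun ω => ?_
  rw [← h.law n]
  exact (lintegral_map (hf.comp measurable_prodMk_left) (h.measurable_mark n)).symm

/-- Campbell's formula for the marked process. -/
lemma tsum_measure_mem (h : IsMarkedPoisson P T Z lam μ) (hlam : 0 < lam) {C : Set (Plane × M)}
    (hC : MeasurableSet C) :
    ∑' n, P {ω | (T n ω, Z n ω) ∈ C} = ((ENNReal.ofReal lam • volume).prod μ) C := by
  have := h.isProbabilityMeasure
  have h1 (n : ℕ) : P {ω | (T n ω, Z n ω) ∈ C}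
      = ∫⁻ x, ∫⁻ z, C.indicator 1 (x, z) ∂μ ∂(P.map (T n)) := by
    rw [← h.lintegral_pair n (measurable_one.indicator hC)]
    exact (lintegral_indicator_one (h.measurable_pair n hC)).symm
  simp_rw [h1]
  rw [← lintegral_sum_measure, h.poisson.sum_map_eq hlam,
    ← lintegral_prod _ (measurable_one.indicator hC).aemeasurable, lintegral_indicator_one hC]

/-- The generating functional of a marked Poisson process. -/
lemma lintegral_infProd (h : IsMarkedPoisson P T Z lam μ) (hlam : 0 < lam)
    {u : Plane × M → ℝ≥0∞} (hu : Measurable u) (hu1 : ∀ x, u x ≤ 1)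
    (hfin : ∫⁻ x, (1 - u x) ∂((ENNReal.ofReal lam • volume).prod μ) ≠ ∞) :
    ∫⁻ ω, infProd (fun n => u (T n ω, Z n ω)) ∂P
      = expNeg (∫⁻ x, (1 - u x) ∂((ENNReal.ofReal lam • volume).prod μ)) := by
  have := h.isProbabilityMeasure
  have hu' : Measurable fun x => 1 - u x := measurable_const.sub hu
  have hw : Measurable fun x => ∫⁻ z, (1 - u (x, z)) ∂μ := hu'.lintegral_prod_right'
  have hw1 (x : Plane) : ∫⁻ z, (1 - u (x, z)) ∂μ ≤ 1 := by
    calc ∫⁻ z, (1 - u (x, z)) ∂μ ≤ ∫⁻ _, 1 ∂μ := lintegral_mono fun z => tsub_le_self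
      _ = 1 := by simp
  have hcompl (x : Plane) : ∫⁻ z, u (x, z) ∂μ = 1 - ∫⁻ z, (1 - u (x, z)) ∂μ := by
    have hle : ∫⁻ z, u (x, z) ∂μ ≤ 1 := by
      calc ∫⁻ z, u (x, z) ∂μ ≤ ∫⁻ _, 1 ∂μ := lintegral_mono fun z => hu1 _
        _ = 1 := by simp
    rw [lintegral_sub (show Measurable fun z => u (x, z) from hu.comp measurable_prodMk_left)
      (ne_top_of_le_ne_top ENNReal.one_ne_top hle) (ae_of_all _ fun z => hu1 _)]
    simp only [lintegral_const, measure_univ, mul_one]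
    rw [ENNReal.sub_sub_cancel ENNReal.one_ne_top hle]
  rw [lintegral_prod _ hu'.aemeasurable] at hfin ⊢
  rw [← h.poisson.lintegral_infProd hlam hw hw1 hfin]
  have hmX (n : ℕ) := h.poisson.measurable n
  refine tendsto_nhds_unique (tendsto_lintegral_of_dominated_convergence (fun _ => 1) ?_ ?_
    (by simp) (ae_of_all _ fun ω => tendsto_infProd fun n => hu1 _)) ?_
  · exact fun N => Finset.measurable_prod _ fun n _ => hu.comp (h.measurable_pair n)
  · exact fun N => ae_of_all _ fun ω => Finset.prod_le_one' fun n _ => hu1 _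
  -- With the points frozen, the marks are independent and each factor may be replaced by its mark
  -- average. This reduces the claim to the unmarked functional with w = ∫(1 - u) dμ.
  have hN (N : ℕ) : ∫⁻ ω, ∏ n ∈ Finset.range N, u (T n ω, Z n ω) ∂P
      = ∫⁻ ω, ∏ n ∈ Finset.range N, (1 - ∫⁻ z, (1 - u (T n ω, z)) ∂μ) ∂P := by
    rw [h.indep_points.lintegral_prodMk (measurable_pi_lambda _ hmX)
      (measurable_pi_lambda _ h.measurable_mark)
      (F := fun q : (ℕ → Plane) × (ℕ → M) => ∏ n ∈ Finset.range N, u (q.1 n, q.2 n))]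
    · refine lintegral_congr fun ω => ?_
      have hm (n : ℕ) : Measurable fun z => u (T n ω, z) := hu.comp measurable_prodMk_left
      rw [lintegral_prod_eq_prod_lintegral_of_indepFun (Finset.range N)
        (fun n ω' => u (T n ω, Z n ω')) (h.indep.comp (fun n z => u (T n ω, z)) hm)
        (fun n => (hm n).comp (h.measurable_mark n))]
      refine Finset.prod_congr rfl fun n _ => ?_
      rw [← hcompl, ← h.law n, lintegral_map (hm n) (h.measurable_mark n)]
    · exact Finset.measurable_prod _ fun n _ => hu.comp (by fun_prop)
  simp_rw [hN]
  refine tendsto_lintegral_of_dominated_convergence (fun _ => 1) ?_ ?_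
    (by simp) (ae_of_all _ fun ω => tendsto_infProd fun n => tsub_le_self)
  · exact fun N => Finset.measurable_prod _ fun n _ =>
      (measurable_const.sub hw).comp (hmX n)
  · exact fun N => ae_of_all _ fun ω => Finset.prod_le_one' fun n _ => tsub_le_self

end IsMarkedPoisson

end MarkedPoisson

/-! ### Exactly one point in a set. -/

section OnePoint

open Filter Topology

lemma infProd_le_finsetProd {f : ℕ → ℝ≥0∞} (hf : ∀ n, f n ≤ 1) (s : Finset ℕ) :
    infProd f ≤ ∏ n ∈ s, f n := by
  obtain ⟨N, hN⟩ : ∃ N, s ⊆ Finset.range N := s.exists_nat_subset_range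
  exact (infProd_le f N).trans (Finset.prod_le_prod_of_subset_of_le_one' hN fun n _ _ => hf n)

variable {Ω M : Type*} [MeasurableSpace Ω] [MeasurableSpace M] {P : Measure Ω}
  {T : ℕ → Ω → Plane} {Z : ℕ → Ω → M} {lam : ℝ} {μ : Measure M}

/-- At t = 0 the bounds force e = exp(-d). The difference quotient at 0 is then squeezed between a
and a + t, so a is the right derivative. -/
lemma eq_mul_exp_of_quadratic_bounds {a c e d : ℝ} (hl : ∀ t ∈ Icc (0 : ℝ) 1, e + t * a ≤ Real.exp (t * c - d))
    (hr : ∀ t ∈ Icc (0 : ℝ) 1, Real.exp (t * c - d) ≤ e + t * a + t ^ 2) :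
    a = c * Real.exp (-d) := by
  have hd : HasDerivAt (fun t : ℝ => Real.exp (t * c - d)) (Real.exp (0 * c - d) * (1 * c)) 0 :=
    (((hasDerivAt_id (0 : ℝ)).mul_const c).sub_const d).exp
  have h0 := hd.tendsto_slope_zero_right
  simp only [zero_mul, zero_sub, zero_add, one_mul, smul_eq_mul] at h0
  have he : e = Real.exp (-d) := by
    have h1 := hl 0 (by simp)
    have h2 := hr 0 (by simp)
    simp only [zero_mul, zero_sub, add_zero, ne_eq, OfNat.ofNat_ne_zero, not_false_eq_true,
      zero_pow] at h1 h2
    exact le_antisymm h1 h2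
  have hev : ∀ᶠ t : ℝ in 𝓝[>] 0, t ∈ Ioc (0 : ℝ) 1 := Ioc_mem_nhdsGT one_pos
  have h1 : Tendsto (fun t : ℝ => a + t) (𝓝[>] 0) (𝓝 a) := by
    have : Tendsto (fun t : ℝ => a + t) (𝓝 0) (𝓝 (a + 0)) :=
      tendsto_const_nhds.add tendsto_id
    rw [add_zero] at this
    exact this.mono_left nhdsWithin_le_nhds
  have h2 := tendsto_of_tendsto_of_tendsto_of_le_of_le' (tendsto_const_nhds (x := a)) h1
    (f := fun t : ℝ => t⁻¹ * (Real.exp (t * c - d) - Real.exp (-d))) (b := 𝓝[>] 0) ?_ ?_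
  · rw [tendsto_nhds_unique h2 h0, mul_comm]
  · filter_upwards [hev] with t ht
    rw [← div_eq_inv_mul, le_div_iff₀ ht.1]
    linarith [hl t ⟨ht.1.le, ht.2⟩]
  · filter_upwards [hev] with t ht
    rw [← div_eq_inv_mul, div_le_iff₀ ht.1]
    nlinarith [hr t ⟨ht.1.le, ht.2⟩]

namespace IsMarkedPoisson

lemma measurableSet_only (h : IsMarkedPoisson P T Z lam μ) (n : ℕ) {C D : Set (Plane × M)}
    (hC : MeasurableSet C) (hD : MeasurableSet D) :
    MeasurableSet {ω | (T n ω, Z n ω) ∈ C ∧ ∀ m, m ≠ n → (T m ω, Z m ω) ∉ D} := by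
  have : {ω | (T n ω, Z n ω) ∈ C ∧ ∀ m, m ≠ n → (T m ω, Z m ω) ∉ D}
      = (fun ω => (T n ω, Z n ω)) ⁻¹' C ∩
        ⋂ m, ⋂ (_ : m ≠ n), ((fun ω => (T m ω, Z m ω)) ⁻¹' D)ᶜ := by
    ext ω
    simp
  rw [this]
  exact (h.measurable_pair n hC).inter (MeasurableSet.iInter fun m =>
    MeasurableSet.iInter fun _ => (h.measurable_pair m hD).compl)

variable [IsProbabilityMeasure P]

/-- For `C ⊆ D` of finite intensity: the probability that exactly one marked point lies in `D`
and that this point lies in `C`. -/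
lemma measure_only (h : IsMarkedPoisson P T Z lam μ) (hlam : 0 < lam) {C D : Set (Plane × M)}
    (hC : MeasurableSet C) (hD : MeasurableSet D) (hCD : C ⊆ D)
    (hfin : ((ENNReal.ofReal lam • volume).prod μ) D ≠ ∞) :
    P {ω | ∃ n, (T n ω, Z n ω) ∈ C ∧ ∀ m, m ≠ n → (T m ω, Z m ω) ∉ D}
      = ((ENNReal.ofReal lam • volume).prod μ) C
        * expNeg (((ENNReal.ofReal lam • volume).prod μ) D) := by
  classical
  have := h.isProbabilityMeasure
  set Λ := (ENNReal.ofReal lam • (volume : Measure Plane)).prod μ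
  have hfinC : Λ C ≠ ∞ := ne_top_of_le_ne_top hfin (measure_mono hCD)
  set E₁ := {ω | ∃ n, (T n ω, Z n ω) ∈ C ∧ ∀ m, m ≠ n → (T m ω, Z m ω) ∉ D}
  set E₀ := {ω | ∀ n, (T n ω, Z n ω) ∉ D}
  have hE₁ : MeasurableSet E₁ := by
    have : E₁ = ⋃ n, {ω | (T n ω, Z n ω) ∈ C ∧ ∀ m, m ≠ n → (T m ω, Z m ω) ∉ D} := by
      ext ω
      simp [E₁]
    rw [this]
    exact MeasurableSet.iUnion fun n => h.measurableSet_only n hC hD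
  have hE₀ : MeasurableSet E₀ := by
    have : E₀ = ⋂ n, ((fun ω => (T n ω, Z n ω)) ⁻¹' D)ᶜ := by
      ext ω
      simp [E₀]
    rw [this]
    exact MeasurableSet.iInter fun n => (h.measurable_pair n hD).compl
  have main (t : ℝ) (ht : t ∈ Icc (0 : ℝ) 1) :
      P E₀ + ENNReal.ofReal t * P E₁ ≤ ENNReal.ofReal (Real.exp (t * (Λ C).toReal - (Λ D).toReal)) ∧
      ENNReal.ofReal (Real.exp (t * (Λ C).toReal - (Λ D).toReal))
        ≤ P E₀ + ENNReal.ofReal t * P E₁ + ENNReal.ofReal t ^ 2 := by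
    set τ := ENNReal.ofReal t with hτ
    have hτ1 : τ ≤ 1 := ENNReal.ofReal_le_one.2 ht.2
    -- The product of u over the points is 1 on `E₀` and t on `E₁`. Elsewhere it is at most t²:
    -- either some point lies in D \ C and kills it, or at least two points lie in C. Its
    -- expectation is exp(tΛ(C) - Λ(D)), so the t-coefficient at 0 identifies P(`E₁`).
    let u : Plane × M → ℝ≥0∞ := fun x => if x ∈ C then τ else if x ∈ D then 0 else 1
    have hu : Measurable u :=
      Measurable.ite hC measurable_const (Measurable.ite hD measurable_const measurable_const)
    have hu1 (x : Plane × M) : u x ≤ 1 := by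
      simp only [u]
      split_ifs <;> simp [hτ1]
    have hint : ∫⁻ x, (1 - u x) ∂Λ = (1 - τ) * Λ C + Λ (D \ C) := by
      have : (fun x => 1 - u x) = fun x => C.indicator (fun _ => 1 - τ) x
          + (D \ C).indicator 1 x := by
        ext x
        by_cases h1 : x ∈ C
        · simp [u, h1]
        · by_cases h2 : x ∈ D <;> simp [u, h1, h2]
      rw [this, lintegral_add_left (measurable_const.indicator hC),
        lintegral_indicator_const hC, lintegral_indicator_one (hD.diff hC)]
    have hdiff : Λ (D \ C) = Λ D - Λ C := measure_sdiff hCD hC.nullMeasurableSet hfinC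
    have hne : ∫⁻ x, (1 - u x) ∂Λ ≠ ∞ := by
      rw [hint]
      exact ENNReal.add_ne_top.2 ⟨ENNReal.mul_ne_top
        (ne_top_of_le_ne_top ENNReal.one_ne_top tsub_le_self) hfinC,
        ne_top_of_le_ne_top hfin (measure_mono sdiff_subset)⟩
    have hG := h.lintegral_infProd hlam hu hu1 hne
    have hval : expNeg (∫⁻ x, (1 - u x) ∂Λ)
        = ENNReal.ofReal (Real.exp (t * (Λ C).toReal - (Λ D).toReal)) := by
      rw [hint, hdiff, expNeg, ENNReal.toReal_add (ENNReal.mul_ne_top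
        (ne_top_of_le_ne_top ENNReal.one_ne_top tsub_le_self) hfinC)
        (ne_top_of_le_ne_top hfin tsub_le_self), ENNReal.toReal_mul,
        ENNReal.toReal_sub_of_le hτ1 ENNReal.one_ne_top,
        ENNReal.toReal_sub_of_le (measure_mono hCD) hfin, ENNReal.toReal_one,
        ENNReal.toReal_ofReal ht.1]
      congr 2; ring
    rw [← hval, ← hG]
    have hlow : P E₀ + τ * P E₁ = ∫⁻ ω, (E₀.indicator 1 ω + τ * E₁.indicator 1 ω) ∂P := by
      rw [lintegral_add_left (measurable_one.indicator hE₀),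
        lintegral_const_mul _ (measurable_one.indicator hE₁), lintegral_indicator_one hE₀,
        lintegral_indicator_one hE₁]
    have hτ2 : τ ^ 2 = ∫⁻ _, τ ^ 2 ∂P := by simp
    have h01 (ω : Ω) (h1 : ω ∈ E₁) : ω ∉ E₀ := by
      obtain ⟨n, hn, -⟩ := h1
      exact fun h0 => h0 n (hCD hn)
    have hv (ω : Ω) (n : ℕ) (hn : (T n ω, Z n ω) ∈ D) : u (T n ω, Z n ω) ≤ τ := by
      simp only [u, hn, if_true]
      split_ifs <;> simp
    constructor
    · rw [hlow]
      refine lintegral_mono fun ω => ?_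
      by_cases h0 : ω ∈ E₀
      · have h1 : ω ∉ E₁ := fun h1 => h01 ω h1 h0
        simp only [h0, h1, indicator_of_mem, indicator_of_notMem, not_false_eq_true, mul_zero,
          add_zero, Pi.one_apply]
        refine le_iInf fun N => (Finset.prod_eq_one fun n _ => ?_).ge
        have : (T n ω, Z n ω) ∉ C := fun hc => h0 n (hCD hc)
        simp [u, h0 n, this]
      · by_cases h1 : ω ∈ E₁
        · simp only [h0, h1, indicator_of_mem, indicator_of_notMem, not_false_eq_true, mul_one,
            zero_add, Pi.one_apply]
          obtain ⟨n, hn, hm⟩ := h1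
          refine le_iInf fun N => ?_
          have hfac (m : ℕ) : (if m = n then τ else 1) ≤ u (T m ω, Z m ω) := by
            by_cases hmn : m = n
            · subst hmn
              simp [u, hn]
            · have : (T m ω, Z m ω) ∉ C := fun hc => hm m hmn (hCD hc)
              simp [u, hm m hmn, this, hmn]
          refine le_trans ?_ (Finset.prod_le_prod' fun m _ => hfac m)
          rw [Finset.prod_ite_eq']
          split_ifs <;> simp [hτ1]
        · simp [h0, h1]
    · rw [hlow, hτ2, ← lintegral_add_right _ measurable_const]
      refine lintegral_mono fun ω => ?_
      by_cases h0 : ω ∈ E₀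
      · refine (infProd_le_one _).trans ?_
        simp only [h0, indicator_of_mem, Pi.one_apply, add_assoc]
        exact le_self_add
      by_cases h1 : ω ∈ E₁
      · obtain ⟨n, hn, -⟩ := id h1
        refine (infProd_le_finsetProd (fun n => hu1 _) {n}).trans ?_
        simp only [h0, h1, Finset.prod_singleton, indicator_of_mem, indicator_of_notMem,
          not_false_eq_true, Pi.one_apply, mul_one, zero_add]
        exact (hv ω n (hCD hn)).trans le_self_add
      · have h0' : ∃ n, (T n ω, Z n ω) ∈ D := by
          by_contra hcon
          exact h0 fun n hn => hcon ⟨n, hn⟩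
        obtain ⟨n, hn⟩ := h0'
        refine le_trans ?_ le_add_self
        by_cases hnC : (T n ω, Z n ω) ∈ C
        · have : ∃ m, m ≠ n ∧ (T m ω, Z m ω) ∈ D := by
            by_contra hcon
            exact h1 ⟨n, hnC, fun m hmn hmD => hcon ⟨m, hmn, hmD⟩⟩
          obtain ⟨m, hmn, hmD⟩ := this
          refine (infProd_le_finsetProd (fun n => hu1 _) {m, n}).trans ?_
          rw [Finset.prod_pair hmn, pow_two]
          exact mul_le_mul' (hv ω m hmD) (hv ω n hn)
        · refine (infProd_le_finsetProd (fun n => hu1 _) {n}).trans ?_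
          simp [u, hn, hnC]
  have hre (t : ℝ) (ht : t ∈ Icc (0 : ℝ) 1) : P E₀ + ENNReal.ofReal t * P E₁
      = ENNReal.ofReal (P.real E₀ + t * P.real E₁) := by
    rw [ENNReal.ofReal_add measureReal_nonneg (mul_nonneg ht.1 measureReal_nonneg),
      ENNReal.ofReal_mul ht.1, ofReal_measureReal, ofReal_measureReal]
  have hreal : P.real E₁ = (Λ C).toReal * Real.exp (-(Λ D).toReal) := by
    refine eq_mul_exp_of_quadratic_bounds (e := P.real E₀) (fun t ht => ?_) (fun t ht => ?_)
    · have := (main t ht).1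
      rw [hre t ht] at this
      exact (ENNReal.ofReal_le_ofReal_iff (Real.exp_pos _).le).1 this
    · have := (main t ht).2
      have hnn : 0 ≤ P.real E₀ + t * P.real E₁ :=
        add_nonneg measureReal_nonneg (mul_nonneg ht.1 measureReal_nonneg)
      rw [hre t ht, ← ENNReal.ofReal_pow ht.1, ← ENNReal.ofReal_add hnn (sq_nonneg t)] at this
      exact (ENNReal.ofReal_le_ofReal_iff (add_nonneg hnn (sq_nonneg t))).1 this
  rw [← ofReal_measureReal (μ := P) (s := E₁), hreal, ENNReal.ofReal_mul ENNReal.toReal_nonneg,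
    ENNReal.ofReal_toReal hfinC, expNeg]

/-- The same probability, as a sum over the points. -/
lemma tsum_measure_only (h : IsMarkedPoisson P T Z lam μ) (hlam : 0 < lam) {C D : Set (Plane × M)}
    (hC : MeasurableSet C) (hD : MeasurableSet D) (hCD : C ⊆ D)
    (hfin : ((ENNReal.ofReal lam • volume).prod μ) D ≠ ∞) :
    ∑' n, P {ω | (T n ω, Z n ω) ∈ C ∧ ∀ m, m ≠ n → (T m ω, Z m ω) ∉ D}
      = ((ENNReal.ofReal lam • volume).prod μ) C
        * expNeg (((ENNReal.ofReal lam • volume).prod μ) D) := by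
  rw [← h.measure_only hlam hC hD hCD hfin, ← measure_iUnion]
  · congr 1
    ext ω
    simp
  · intro n n' hn
    refine Set.disjoint_left.2 fun ω h1 h2 => ?_
    exact h1.2 n' hn.symm (hCD h2.1)
  · exact fun n => h.measurableSet_only n hC hD

end IsMarkedPoisson

end OnePoint

/-! ### Expected number of strict maximizers of a score. -/

section StrictMaximum

open Filter Topology

lemma ENNReal.tendsto_tsum_of_monotone {f : ℕ → ℕ → ℝ≥0∞} {g : ℕ → ℝ≥0∞}
    (hmono : ∀ n, Monotone fun d => f d n) (hlim : ∀ n, Tendsto (fun d => f d n) atTop (𝓝 (g n))) :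
    Tendsto (fun d => ∑' n, f d n) atTop (𝓝 (∑' n, g n)) := by
  simp_rw [← lintegral_count]
  exact lintegral_tendsto_of_tendsto_of_monotone (fun d => measurable_from_top.aemeasurable)
    (ae_of_all _ hmono) (ae_of_all _ hlim)

namespace IsMarkedPoisson

variable {Ω M : Type*} [MeasurableSpace Ω] [MeasurableSpace M] {P : Measure Ω}
  {T : ℕ → Ω → Plane} {Z : ℕ → Ω → M} {lam : ℝ} {μ : Measure M} [IsProbabilityMeasure P]

/-- Borel–Cantelli: the expected number of points above each positive threshold is finite. The + 1
keeps the threshold finite at k = 0. -/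
lemma ae_finite_ge (h : IsMarkedPoisson P T Z lam μ) (hlam : 0 < lam) {S : Plane × M → ℝ≥0∞}
    (hS : Measurable S)
    (hfin : ∀ s, s ≠ 0 → s ≠ ∞ → ((ENNReal.ofReal lam • volume).prod μ) {x | s ≤ S x} ≠ ∞) :
    ∀ᵐ ω ∂P, ∀ k : ℕ, {m | ((k : ℝ≥0∞) + 1)⁻¹ ≤ S (T m ω, Z m ω)}.Finite := by
  refine ae_all_iff.2 fun k => ?_
  refine ae_finite_setOfPred_mem (s := fun m => {ω | ((k : ℝ≥0∞) + 1)⁻¹ ≤ S (T m ω, Z m ω)}) ?_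
  have := h.tsum_measure_mem hlam (C := {x | ((k : ℝ≥0∞) + 1)⁻¹ ≤ S x}) (hS measurableSet_Ici)
  exact this ▸ hfin _ (by simp) (by simp)

/-- The expected number of marked points in `A` that strictly maximize the score `S`. -/
theorem tsum_measure_strictMax (h : IsMarkedPoisson P T Z lam μ) (hlam : 0 < lam)
    {S : Plane × M → ℝ≥0∞} (hS : Measurable S)
    (hfin : ∀ s, s ≠ 0 → s ≠ ∞ → ((ENNReal.ofReal lam • volume).prod μ) {x | s ≤ S x} ≠ ∞)
    {A : Set (Plane × M)} (hA : MeasurableSet A) (hA0 : ∀ x ∈ A, S x ≠ 0) :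
    ∑' n, P {ω | (T n ω, Z n ω) ∈ A ∧ ∀ m, m ≠ n → S (T m ω, Z m ω) < S (T n ω, Z n ω)}
      = ∫⁻ x in A, expNeg (((ENNReal.ofReal lam • volume).prod μ) {y | S x ≤ S y})
          ∂((ENNReal.ofReal lam • volume).prod μ) := by
  classical
  have := h.isProbabilityMeasure
  set Λ := (ENNReal.ofReal lam • (volume : Measure Plane)).prod μ
  -- `L d` takes finitely many finite values and increases to S. For each nonzero value s, the
  -- one-point formula applies with C = A ∩ {`L d` = s} and D = {S ≥ s}; C ⊆ D because `L d` ≤ S.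
  let L := SimpleFunc.eapprox S
  have hLmono (x : Plane × M) : Monotone fun d => L d x :=
    fun d e hde => SimpleFunc.monotone_eapprox S hde x
  have hLlim (x : Plane × M) : Tendsto (fun d => L d x) atTop (𝓝 (S x)) :=
    SimpleFunc.tendsto_eapprox hS x
  have hLle (d : ℕ) (x : Plane × M) : L d x ≤ S x := (hLmono x).ge_of_tendsto (hLlim x) d
  have hLtop (d : ℕ) (x : Plane × M) : L d x ≠ ∞ := (SimpleFunc.eapprox_lt_top S d x).ne
  -- The rivals must stay below the rounded-down score of point n. This is stronger than being a
  -- strict maximizer, and it increases with d to that event up to a null set.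
  let V : ℕ → ℕ → Set Ω := fun d n => {ω | (T n ω, Z n ω) ∈ A ∧ L d (T n ω, Z n ω) ≠ 0 ∧
    ∀ m, m ≠ n → S (T m ω, Z m ω) < L d (T n ω, Z n ω)}
  let R : ℕ → Finset ℝ≥0∞ := fun d => (L d).range.filter (· ≠ 0)
  -- The value 0 is imposed where `L d` vanishes: there {y | 0 ≤ S y} is the whole space, of
  -- infinite intensity, and `expNeg` would return 1.
  let g : ℕ → Plane × M → ℝ≥0∞ := fun d x =>
    if L d x = 0 then 0 else expNeg (Λ {y | L d x ≤ S y})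
  have hg (d : ℕ) (x : Plane × M) : g d x =
      ∑ s ∈ R d, (L d ⁻¹' {s}).indicator (fun _ => expNeg (Λ {y | s ≤ S y})) x := by
    by_cases hx : L d x = 0
    · rw [Finset.sum_eq_zero]
      · simp [g, hx]
      · intro s hs
        refine indicator_of_notMem (s := L d ⁻¹' {s}) (fun hxs : L d x = s => ?_) _
        exact (Finset.mem_filter.1 hs).2 (hxs ▸ hx)
    · rw [Finset.sum_eq_single (L d x)]
      · simp [g, hx]
      · intro s _ hs
        exact indicator_of_notMem (s := L d ⁻¹' {s}) (fun hxs : L d x = s => hs hxs.symm) _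
      · intro hx'
        exact absurd (Finset.mem_filter.2 ⟨SimpleFunc.mem_range_self _ _, hx⟩) hx'
  have hgm (d : ℕ) : Measurable (g d) := by
    have : g d = fun x => ∑ s ∈ R d,
        (L d ⁻¹' {s}).indicator (fun _ => expNeg (Λ {y | s ≤ S y})) x := funext (hg d)
    rw [this]
    exact Finset.measurable_sum _ fun s _ => measurable_const.indicator ((L d).measurableSet_fiber s)
  have hlevel (d : ℕ) : ∑' n, P (V d n) = ∫⁻ x in A, g d x ∂Λ := by
    have hO (s : ℝ≥0∞) : MeasurableSet {y | s ≤ S y} := hS measurableSet_Ici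
    have hC (s : ℝ≥0∞) : MeasurableSet (A ∩ L d ⁻¹' {s}) :=
      hA.inter ((L d).measurableSet_fiber s)
    have hsplit (n : ℕ) : P (V d n) = ∑ s ∈ R d, P {ω | (T n ω, Z n ω) ∈ A ∩ L d ⁻¹' {s} ∧
        ∀ m, m ≠ n → (T m ω, Z m ω) ∉ {y | s ≤ S y}} := by
      rw [← measure_biUnion_finset]
      · congr 1
        ext ω
        simp only [V, mem_ofPred_eq, mem_iUnion, not_le, mem_inter_iff, mem_preimage,
          mem_singleton_iff, exists_prop]
        constructor
        · rintro ⟨h1, h2, h3⟩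
          exact ⟨_, Finset.mem_filter.2 ⟨SimpleFunc.mem_range_self _ _, h2⟩, ⟨h1, rfl⟩, h3⟩
        · rintro ⟨s, hs, ⟨h1, rfl⟩, h3⟩
          exact ⟨h1, (Finset.mem_filter.1 hs).2, h3⟩
      · intro s _ t _ hst
        refine Set.disjoint_left.2 fun ω h1 h2 => hst ?_
        exact (h1.1.2 : L d _ = s).symm.trans h2.1.2
      · exact fun s _ => h.measurableSet_only n (hC s) (hO s)
    simp_rw [hsplit, hg]
    rw [Summable.tsum_finsetSum fun _ _ => ENNReal.summable,
      lintegral_finsetSum _ fun s _ => measurable_const.indicator ((L d).measurableSet_fiber s)]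
    refine Finset.sum_congr rfl fun s hs => ?_
    obtain ⟨hs1, hs0⟩ := Finset.mem_filter.1 hs
    obtain ⟨x, rfl⟩ := SimpleFunc.mem_range.1 hs1
    rw [h.tsum_measure_only hlam (hC _) (hO _) _ (hfin _ hs0 (hLtop d x)),
      lintegral_indicator_const ((L d).measurableSet_fiber _),
      Measure.restrict_apply ((L d).measurableSet_fiber _), mul_comm, inter_comm]
    rintro y ⟨-, hy⟩
    exact (show L d y = L d x from hy) ▸ hLle d y
  have hleft : Tendsto (fun d => ∑' n, P (V d n)) atTop (𝓝 (∑' n, P {ω | (T n ω, Z n ω) ∈ A ∧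
      ∀ m, m ≠ n → S (T m ω, Z m ω) < S (T n ω, Z n ω)})) := by
    have hVmono (n : ℕ) : Monotone fun d => V d n := by
      rintro d e hde ω ⟨h1, h2, h3⟩
      refine ⟨h1, fun h0 => h2 (le_antisymm (h0 ▸ hLmono _ hde) zero_le), fun m hm => ?_⟩
      exact (h3 m hm).trans_le (hLmono _ hde)
    refine ENNReal.tendsto_tsum_of_monotone
      (fun n d e hde => measure_mono (hVmono n hde)) fun n => ?_
    have hU : P {ω | (T n ω, Z n ω) ∈ A ∧ ∀ m, m ≠ n → S (T m ω, Z m ω) < S (T n ω, Z n ω)}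
        = P (⋃ d, V d n) := by
      refine measure_congr ?_
      filter_upwards [h.ae_finite_ge hlam hS hfin] with ω hω
      refine propext ?_
      change ((T n ω, Z n ω) ∈ A ∧ ∀ m, m ≠ n → S (T m ω, Z m ω) < S (T n ω, Z n ω))
        ↔ ω ∈ ⋃ d, V d n
      rw [mem_iUnion]
      constructor
      · rintro ⟨h1, h2⟩
        -- Only finitely many rivals score at least (k+1)⁻¹, so their supremum is strictly below the
        -- winner's score. Some `L d` at the winner exceeds both this supremum and (k+1)⁻¹; with
        -- infinitely many rivals the supremum might not be strictly below.
        obtain ⟨k, hk⟩ := ENNReal.exists_inv_nat_lt (hA0 _ h1)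
        have hk' : ((k : ℝ≥0∞) + 1)⁻¹ < S (T n ω, Z n ω) :=
          lt_of_le_of_lt (ENNReal.inv_le_inv.2 le_self_add) hk
        have hsup : ((hω k).toFinset.erase n).sup (fun m => S (T m ω, Z m ω))
            < S (T n ω, Z n ω) :=
          (Finset.sup_lt_iff (bot_le.trans_lt hk')).2 fun m hm => h2 m (Finset.ne_of_mem_erase hm)
        obtain ⟨d, hd⟩ := ((hLlim (T n ω, Z n ω)).eventually
          (lt_mem_nhds (max_lt hk' hsup))).exists
        refine ⟨d, h1, (bot_le.trans_lt hd).ne', fun m hm => ?_⟩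
        by_cases hmk : ((k : ℝ≥0∞) + 1)⁻¹ ≤ S (T m ω, Z m ω)
        · refine lt_of_le_of_lt ?_ ((le_max_right _ _).trans_lt hd)
          exact Finset.le_sup (f := fun m => S (T m ω, Z m ω))
            (Finset.mem_erase.2 ⟨hm, (hω k).mem_toFinset.2 hmk⟩)
        · exact (not_le.1 hmk).trans ((le_max_left _ _).trans_lt hd)
      · rintro ⟨d, h1, -, h3⟩
        exact ⟨h1, fun m hm => (h3 m hm).trans_le (hLle d _)⟩
    rw [hU]
    exact tendsto_measure_iUnion_atTop (hVmono n)
  have hright : Tendsto (fun d => ∫⁻ x in A, g d x ∂Λ) atTop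
      (𝓝 (∫⁻ x in A, expNeg (Λ {y | S x ≤ S y}) ∂Λ)) := by
    refine lintegral_tendsto_of_tendsto_of_monotone (fun d => (hgm d).aemeasurable)
      (ae_of_all _ fun x d e hde => ?_) ?_
    · simp only [g]
      by_cases h0 : L d x = 0
      · simp [h0]
      · have h0' : L e x ≠ 0 := fun he => h0 (le_antisymm (he ▸ hLmono x hde) zero_le)
        rw [if_neg h0, if_neg h0']
        refine expNeg_anti (measure_mono fun y hy => ?_) (hfin _ h0 (hLtop d x))
        exact (hLmono x hde).trans hy
    · filter_upwards [ae_restrict_mem hA] with x hx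
      have hev : ∀ᶠ d in atTop, L d x ≠ 0 := (hLlim x).eventually_ne (hA0 x hx)
      -- Continuity from above of Λ applies, since the sets have finite intensity as soon as `L d x`
      -- is nonzero.
      have hinter : {y | S x ≤ S y} = ⋂ d, {y | L d x ≤ S y} := by
        ext y
        simp only [mem_ofPred_eq, mem_iInter]
        exact ⟨fun hy d => (hLle d x).trans hy, fun hy => le_of_tendsto' (hLlim x) hy⟩
      obtain ⟨d₀, hd₀⟩ := hev.exists
      have hne : Λ {y | S x ≤ S y} ≠ ∞ := ne_top_of_le_ne_top (hfin _ hd₀ (hLtop d₀ x))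
        (measure_mono fun y hy => (hLle d₀ x).trans hy)
      have hlim : Tendsto (fun d => Λ {y | L d x ≤ S y}) atTop (𝓝 (Λ {y | S x ≤ S y})) := by
        rw [hinter]
        exact tendsto_measure_iInter_atTop (fun d => (hS measurableSet_Ici).nullMeasurableSet)
          (fun d e hde y hy => (hLmono x hde).trans hy) ⟨d₀, hfin _ hd₀ (hLtop d₀ x)⟩
      refine (tendsto_expNeg hne hlim).congr' ?_
      filter_upwards [hev] with d hd
      simp [g, hd]
  simp_rw [hlevel] at hleft
  exact tendsto_nhds_unique hleft hright

end IsMarkedPoisson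

end StrictMaximum

/-! ### Almost sure distinctness of the points. -/

section Simplicity

open Filter Topology

lemma volume_annulus {a b : ℝ} (ha : 0 ≤ a) (hab : a ≤ b) :
    volume {x : Plane | ‖x‖ ^ 2 ∈ Ico a b} = ENNReal.ofReal (Real.pi * (b - a)) := by
  have hball (c : ℝ) (hc : 0 ≤ c) : volume (Metric.ball (0 : Plane) (√c))
      = ENNReal.ofReal (Real.pi * c) := by
    rw [EuclideanSpace.volume_ball_fin_two, ← ENNReal.ofReal_pow (Real.sqrt_nonneg _),
      Real.sq_sqrt hc, ← ENNReal.ofReal_mul hc, mul_comm]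
  have heq : {x : Plane | ‖x‖ ^ 2 ∈ Ico a b}
      = Metric.ball (0 : Plane) (√b) \ Metric.ball (0 : Plane) (√a) := by
    ext x
    simp only [mem_ofPred_eq, mem_Ico, Set.mem_sdiff, mem_ball_zero_iff, not_lt,
      Real.lt_sqrt (norm_nonneg x)]
    exact and_comm
  rw [heq, measure_sdiff (Metric.ball_subset_ball (Real.sqrt_le_sqrt hab))
    Metric.isOpen_ball.measurableSet.nullMeasurableSet measure_ball_lt_top.ne, hball b (ha.trans hab),
    hball a ha, ← ENNReal.ofReal_sub _ (mul_nonneg Real.pi_pos.le ha), mul_sub]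

namespace IsMarkedPoisson

variable {Ω M : Type*} [MeasurableSpace Ω] [MeasurableSpace M] {P : Measure Ω}
  {T : ℕ → Ω → Plane} {Z : ℕ → Ω → M} {lam : ℝ} {μ : Measure M} [IsProbabilityMeasure P]

/-- The points of a Poisson process are almost surely pairwise distinct. -/
theorem ae_injective (h : IsMarkedPoisson P T Z lam μ) (hlam : 0 < lam) :
    ∀ᵐ ω ∂P, Function.Injective fun n => T n ω := by
  have := h.isProbabilityMeasure
  have hTm := h.poisson.measurable
  -- Annuli are parametrized by squared radius, so equal increments give equal areas.
  let D : ℝ → ℝ → Set Plane := fun a b => {x | ‖x‖ ^ 2 ∈ Ico a b}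
  have hD (a b : ℝ) : MeasurableSet (D a b) :=
    (measurable_norm.pow_const 2) measurableSet_Ico
  have hEq (n m : ℕ) : MeasurableSet {ω | T m ω = T n ω} := measurableSet_eq_fun (hTm m) (hTm n)
  let V : ℕ → ℕ → Set Ω := fun k n => {ω | T n ω ∈ D 0 k ∧ ∀ m, m ≠ n → T m ω ≠ T n ω}
  have hV (k n : ℕ) : MeasurableSet (V k n) := by
    have : V k n = T n ⁻¹' D 0 k ∩ ⋂ m, ⋂ (_ : m ≠ n), {ω | T m ω = T n ω}ᶜ := by
      ext ω
      simp [V]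
    rw [this]
    exact (hTm n (hD _ _)).inter (MeasurableSet.iInter fun m =>
      MeasurableSet.iInter fun _ => (hEq n m).compl)
  have hmeanval (k : ℕ) : ∑' n, P (T n ⁻¹' D 0 k) = ENNReal.ofReal (lam * (Real.pi * k)) := by
    have hvol : volume (D 0 k) = ENNReal.ofReal (Real.pi * k) := by
      have := volume_annulus (le_refl (0 : ℝ)) (Nat.cast_nonneg k)
      rwa [sub_zero] at this
    rw [h.poisson.tsum_measure_mem hlam (hD _ _) (by simp [hvol]), hvol, ENNReal.ofReal_mul hlam.le]
  -- Cut the disc into J annuli of equal area. A point alone in its annulus coincides with no other,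
  -- and the expected number of such points is the full mean times a factor tending to 1 as J grows.
  have hlow (k J : ℕ) (hJ : 0 < J) : ENNReal.ofReal (lam * (Real.pi * k) *
      Real.exp (-(lam * (Real.pi * (k / J))))) ≤ ∑' n, P (V k n) := by
    have hJ' : (0 : ℝ) < J := Nat.cast_pos.2 hJ
    set r : ℝ := k / J
    have hr : 0 ≤ r := by positivity
    let C : ℕ → Set (Plane × M) := fun j => D (j * r) ((j + 1) * r) ×ˢ univ
    have hC (j : ℕ) : MeasurableSet (C j) := (hD _ _).prod MeasurableSet.univ
    have hΛ (j : ℕ) : ((ENNReal.ofReal lam • volume).prod μ) (C j)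
        = ENNReal.ofReal (lam * (Real.pi * r)) := by
      simp only [C]
      rw [Measure.prod_prod, measure_univ, mul_one, Measure.smul_apply, smul_eq_mul,
        volume_annulus (by positivity) (by nlinarith), ENNReal.ofReal_mul hlam.le]
      congr 3; ring
    have hone (j : ℕ) := h.tsum_measure_only hlam (hC j) (hC j) subset_rfl (by simp [hΛ])
    calc ENNReal.ofReal (lam * (Real.pi * k) * Real.exp (-(lam * (Real.pi * r))))
        = ∑ j ∈ Finset.range J, ENNReal.ofReal (lam * (Real.pi * r))
            * expNeg (ENNReal.ofReal (lam * (Real.pi * r))) := by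
          rw [Finset.sum_const, Finset.card_range, nsmul_eq_mul, expNeg,
            ENNReal.toReal_ofReal (by positivity), ← ENNReal.ofReal_natCast,
            ← ENNReal.ofReal_mul (by positivity), ← ENNReal.ofReal_mul (by positivity)]
          congr 1
          simp only [r]
          field_simp
      _ = ∑' n, ∑ j ∈ Finset.range J,
            P {ω | (T n ω, Z n ω) ∈ C j ∧ ∀ m, m ≠ n → (T m ω, Z m ω) ∉ C j} := by
          rw [Summable.tsum_finsetSum fun _ _ => ENNReal.summable]
          simp_rw [hone, hΛ]
      _ ≤ ∑' n, P (V k n) := by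
          refine ENNReal.tsum_le_tsum fun n => ?_
          rw [← measure_biUnion_finset]
          · refine measure_mono (iUnion₂_subset fun j hj => ?_)
            rintro ω ⟨⟨h1, -⟩, h2⟩
            have h1' : ‖T n ω‖ ^ 2 ∈ Ico (j * r) ((j + 1) * r) := h1
            refine ⟨⟨by positivity, h1'.2.trans_le ?_⟩, fun m hm heq => h2 m hm ⟨?_, trivial⟩⟩
            · have : ((j : ℝ) + 1) ≤ J := by exact_mod_cast Finset.mem_range.1 hj
              calc ((j : ℝ) + 1) * r ≤ J * r := by gcongr
                _ = k := by simp only [r]; field_simp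
            · rw [heq]
              exact h1
          · intro i _ j _ hij
            refine Set.disjoint_left.2 fun ω h1 h2 => ?_
            have hi : ‖T n ω‖ ^ 2 ∈ Ico (i * r) ((i + 1) * r) := h1.1.1
            have hj : ‖T n ω‖ ^ 2 ∈ Ico (j * r) ((j + 1) * r) := h2.1.1
            rcases lt_or_gt_of_ne hij with hlt | hlt
            · have : (i : ℝ) + 1 ≤ j := by exact_mod_cast hlt
              have := mul_le_mul_of_nonneg_right this hr
              linarith [hi.2, hj.1]
            · have : (j : ℝ) + 1 ≤ i := by exact_mod_cast hlt
              have := mul_le_mul_of_nonneg_right this hr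
              linarith [hj.2, hi.1]
          · exact fun j _ => h.measurableSet_only n (hC j) (hC j)
  have hge (k : ℕ) : ∑' n, P (T n ⁻¹' D 0 k) ≤ ∑' n, P (V k n) := by
    rw [hmeanval]
    have hlim : Tendsto (fun J : ℕ => ENNReal.ofReal (lam * (Real.pi * k) *
        Real.exp (-(lam * (Real.pi * (k / J)))))) atTop
        (𝓝 (ENNReal.ofReal (lam * (Real.pi * k) * Real.exp (-(lam * (Real.pi * 0)))))) := by
      refine ENNReal.tendsto_ofReal (tendsto_const_nhds.mul
        (Real.continuous_exp.continuousAt.tendsto.comp ?_))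
      exact ((tendsto_const_nhds.div_atTop tendsto_natCast_atTop_atTop).const_mul _).const_mul _
        |>.neg
    simp only [mul_zero, neg_zero, Real.exp_zero, mul_one] at hlim
    refine le_of_tendsto hlim ?_
    filter_upwards [eventually_gt_atTop 0] with J hJ using hlow k J hJ
  -- Nested events whose probabilities have equal finite sums differ only by null sets.
  have hnull (k n : ℕ) : P (T n ⁻¹' D 0 k \ V k n) = 0 := by
    have hsub (n : ℕ) : V k n ⊆ T n ⁻¹' D 0 k := fun ω hω => hω.1
    have hsum : ∑' n, P (T n ⁻¹' D 0 k) = ∑' n, P (V k n) + ∑' n, P (T n ⁻¹' D 0 k \ V k n) := by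
      rw [← ENNReal.tsum_add]
      congr 1 with n
      have := measure_inter_add_sdiff (μ := P) (T n ⁻¹' D 0 k) (hV k n)
      rwa [inter_eq_right.2 (hsub n), eq_comm] at this
    have hne : ∑' n, P (V k n) ≠ ∞ :=
      ne_top_of_le_ne_top (by rw [hmeanval]; exact ENNReal.ofReal_ne_top)
        (ENNReal.tsum_le_tsum fun n => measure_mono (hsub n))
    have hzero : ∑' n, P (T n ⁻¹' D 0 k \ V k n) = 0 := by
      have h2 : ∑' n, P (V k n) + ∑' n, P (T n ⁻¹' D 0 k \ V k n) ≤ ∑' n, P (V k n) + 0 := by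
        rw [add_zero, ← hsum]
        exact hge k
      exact le_antisymm ((ENNReal.add_le_add_iff_left hne).1 h2) zero_le
    exact ENNReal.tsum_eq_zero.1 hzero n
  have hae : ∀ᵐ ω ∂P, ∀ k n : ℕ, ω ∉ T n ⁻¹' D 0 k \ V k n :=
    ae_all_iff.2 fun k => ae_all_iff.2 fun n => measure_eq_zero_iff_ae_notMem.1 (hnull k n)
  filter_upwards [hae] with ω hω
  intro m n hmn
  by_contra hne
  obtain ⟨k, hk⟩ := exists_nat_gt (‖T n ω‖ ^ 2)
  exact hω k n ⟨⟨by positivity, hk⟩, fun hv => hv.2 m hne hmn⟩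

end IsMarkedPoisson

end Simplicity

/-! ### From the Palm measure to an integral over locations. -/

section Network

open Filter Topology

variable {Ω M : Type*} {K : ℕ}

/-- The law of the pair (tier, fading mark) of an access point. -/
noncomputable def markLaw [MeasurableSpace M] (p : Fin K → ℝ) (ν : Fin K → Measure M) :
    Measure (Fin K × M) :=
  ∑ k, ENNReal.ofReal (p k) • (ν k).map (Prod.mk k)

lemma lintegral_markLaw [MeasurableSpace M] (p : Fin K → ℝ) (ν : Fin K → Measure M)
    {f : Fin K × M → ℝ≥0∞} (hf : Measurable f) :
    ∫⁻ z, f z ∂(markLaw p ν) = ∑ k, ENNReal.ofReal (p k) * ∫⁻ m, f (k, m) ∂(ν k) := by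
  rw [markLaw, lintegral_finsetSum_measure]
  refine Finset.sum_congr rfl fun k _ => ?_
  rw [lintegral_smul_measure, lintegral_map hf measurable_prodMk_left, smul_eq_mul]

namespace HetNet

/-- The power received at `y` from an access point at `x.1` of tier `x.2.1` with fading mark
`x.2.2`. -/
noncomputable def score (N : HetNet Ω M K) (y : Plane) (x : Plane × (Fin K × M)) : ℝ≥0∞ :=
  (N.pow x.2.1 : ℝ≥0∞) * (N.fading x.2.2 (y - x.1) : ℝ≥0∞)
    * (edist x.1 y) ^ (-(N.ple x.2.1))

lemma received_eq_score (N : HetNet Ω M K) (n : ℕ) (ω : Ω) (y : Plane) :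
    N.received n ω y = N.score y (N.T n ω, (N.tier n ω, N.mark n ω)) := rfl

lemma mem_tierAtOrigin_flow {N : HetNet Ω M K} (hN : N.IsCompatible) (x : Plane) (ω : Ω)
    (i : Fin K) :
    N.θ x ω ∈ N.tierAtOrigin i ↔ ∃ n, N.T n ω = x ∧ N.tier n ω = i := by
  obtain ⟨σ, hσ⟩ := hN x ω
  change (∃ n, N.T n (N.θ x ω) = 0 ∧ N.tier n (N.θ x ω) = i) ↔ _
  rw [← σ.exists_congr_right]
  refine exists_congr fun n => ?_
  rw [(hσ n).1, (hσ n).2.1, sub_eq_zero]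

lemma received_flow {N : HetNet Ω M K} {x : Plane} {ω : Ω} {σ : Equiv.Perm ℕ}
    (hσ : ∀ n, N.T (σ n) (N.θ x ω) = N.T n ω - x ∧ N.tier (σ n) (N.θ x ω) = N.tier n ω ∧
      N.mark (σ n) (N.θ x ω) = N.mark n ω) (n : ℕ) (y : Plane) :
    N.received (σ n) (N.θ x ω) y = N.received n ω (y + x) := by
  rw [received_eq_score, received_eq_score, (hσ n).1, (hσ n).2.1, (hσ n).2.2]
  simp only [score]
  have h1 : y - (N.T n ω - x) = y + x - N.T n ω := by abel
  have h2 : edist (N.T n ω - x) y = edist (N.T n ω) (y + x) := by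
    rw [← edist_add_right (N.T n ω - x) y x, sub_add_cancel]
  rw [h1, h2]

/-- The renumbering of the points is absorbed by reindexing both the server and its rivals. -/
lemma cell_flow {N : HetNet Ω M K} (hN : N.IsCompatible) (x : Plane) (ω : Ω) :
    N.cell (N.θ x ω) 0 = (fun y => y + x) ⁻¹' N.cell ω x := by
  obtain ⟨σ, hσ⟩ := hN x ω
  ext y
  change (∃ n, N.T n (N.θ x ω) = 0 ∧ ∀ m, m ≠ n →
    N.received m (N.θ x ω) y < N.received n (N.θ x ω) y) ↔ N.Serves ω x (y + x)
  rw [← σ.exists_congr_right, Serves]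
  refine exists_congr fun n => ?_
  rw [(hσ n).1, sub_eq_zero, ← σ.forall_congr_right]
  simp only [received_flow hσ, ne_eq, σ.injective.eq_iff]

lemma volume_cell_flow {N : HetNet Ω M K} (hN : N.IsCompatible) (x : Plane) (ω : Ω) :
    volume (N.cell (N.θ x ω) 0) = volume (N.cell ω x) := by
  rw [cell_flow hN, measure_preimage_add_right]

lemma cell_of_injective {N : HetNet Ω M K} {ω : Ω} (hω : Function.Injective fun n => N.T n ω)
    (n : ℕ) : N.cell ω (N.T n ω) = {y | ∀ m, m ≠ n → N.received m ω y < N.received n ω y} := by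
  ext y
  constructor
  · rintro ⟨n', hn', h⟩
    obtain rfl : n' = n := hω hn'
    exact h
  · exact fun h => ⟨n, rfl, h⟩

variable [MeasurableSpace M]

lemma measurable_score {N : HetNet Ω M K} (hf : Measurable (Function.uncurry N.fading)) :
    Measurable fun q : Plane × (Plane × (Fin K × M)) => N.score q.1 q.2 := by
  have h1 : Measurable fun q : Plane × (Plane × (Fin K × M)) => (N.pow q.2.2.1 : ℝ≥0∞) :=
    (Measurable.of_discrete (f := fun k => (N.pow k : ℝ≥0∞))).comp (by fun_prop)
  have h2 : Measurable fun q : Plane × (Plane × (Fin K × M)) =>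
      (N.fading q.2.2.2 (q.1 - q.2.1) : ℝ≥0∞) := by
    have : Measurable fun q : Plane × (Plane × (Fin K × M)) => (q.2.2.2, q.1 - q.2.1) := by
      fun_prop
    exact (hf.comp this).coe_nnreal_ennreal
  have h3 : Measurable fun q : Plane × (Plane × (Fin K × M)) => -(N.ple q.2.2.1) :=
    (Measurable.of_discrete (f := fun k => -(N.ple k))).comp (by fun_prop)
  have h4 : Measurable fun q : Plane × (Plane × (Fin K × M)) => edist q.2.1 q.1 := by fun_prop
  exact (h1.mul h2).mul (h4.pow h3)

namespace IsPoissonNetwork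

variable [MeasurableSpace Ω] {P : Measure Ω} {N : HetNet Ω M K} {lam : ℝ} {p : Fin K → ℝ}
  {ν : Fin K → Measure M} {γ : Fin K → Measure ℝ≥0}

lemma measurable_received (hN : N.IsPoissonNetwork P lam p ν γ) (n : ℕ) :
    Measurable fun q : Ω × Plane => N.received n q.1 q.2 := by
  have h1 := hN.poisson.measurable n
  have h2 := hN.measurable_tier n
  have h3 := hN.measurable_mark n
  exact (measurable_score hN.measurable_fading).comp
    (f := fun q : Ω × Plane => (q.2, (N.T n q.1, (N.tier n q.1, N.mark n q.1)))) (by fun_prop)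

lemma measurableSet_strictMax (hN : N.IsPoissonNetwork P lam p ν γ) (n : ℕ) :
    MeasurableSet {q : Ω × Plane | ∀ m, m ≠ n → N.received m q.1 q.2 < N.received n q.1 q.2} := by
  have : {q : Ω × Plane | ∀ m, m ≠ n → N.received m q.1 q.2 < N.received n q.1 q.2}
      = ⋂ m, ⋂ (_ : m ≠ n), {q | N.received m q.1 q.2 < N.received n q.1 q.2} := by
    ext q
    simp
  rw [this]
  exact MeasurableSet.iInter fun m => MeasurableSet.iInter fun _ =>
    measurableSet_lt (hN.measurable_received m) (hN.measurable_received n)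

lemma measurable_volume_cell (hN : N.IsPoissonNetwork P lam p ν γ) :
    Measurable fun ω => volume (N.cell ω 0) := by
  have hset : MeasurableSet {q : Ω × Plane | N.Serves q.1 0 q.2} := by
    have : {q : Ω × Plane | N.Serves q.1 0 q.2} = ⋃ n, ((N.T n ∘ Prod.fst) ⁻¹' {0} ∩
        {q : Ω × Plane | ∀ m, m ≠ n → N.received m q.1 q.2 < N.received n q.1 q.2}) := by
      ext q
      simp [Serves]
    rw [this]
    exact MeasurableSet.iUnion fun n => (((hN.poisson.measurable n).comp measurable_fst)
      (measurableSet_singleton 0)).inter (hN.measurableSet_strictMax n)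
  exact measurable_measure_prodMk_left hset

lemma measurableSet_tierAtOrigin (hN : N.IsPoissonNetwork P lam p ν γ) (i : Fin K) :
    MeasurableSet (N.tierAtOrigin i) := by
  have : N.tierAtOrigin i = ⋃ n, (N.T n ⁻¹' {0} ∩ N.tier n ⁻¹' {i}) := by
    ext ω
    simp [tierAtOrigin]
  rw [this]
  exact MeasurableSet.iUnion fun n => (hN.poisson.measurable n (measurableSet_singleton 0)).inter
    (hN.measurable_tier n (measurableSet_singleton i))

lemma isMarkedPoisson (hN : N.IsPoissonNetwork P lam p ν γ) :
    IsMarkedPoisson P N.T (fun n ω => (N.tier n ω, N.mark n ω)) lam (markLaw p ν) where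
  poisson := hN.poisson
  measurable_mark n := (hN.measurable_tier n).prodMk (hN.measurable_mark n)
  indep := hN.marks_indep
  indep_points := hN.marks_indep_points
  law n := by
    have hm := (hN.measurable_tier n).prodMk (hN.measurable_mark n)
    ext s hs
    rw [Measure.map_apply hm hs, ← lintegral_indicator_one hs,
      lintegral_markLaw p ν (measurable_one.indicator hs)]
    have hset : (fun ω => (N.tier n ω, N.mark n ω)) ⁻¹' s
        = ⋃ k ∈ Finset.univ, {ω | N.tier n ω = k ∧ N.mark n ω ∈ Prod.mk k ⁻¹' s} := by
      ext ω
      simp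
    rw [hset, measure_biUnion_finset]
    · refine Finset.sum_congr rfl fun k _ => ?_
      rw [hN.mark_law n k _ (measurable_prodMk_left hs)]
      congr 1
      exact (lintegral_indicator_one (measurable_prodMk_left hs)).symm
    · intro k _ l _ hkl
      exact Set.disjoint_left.2 fun ω h1 h2 => hkl (h1.1.symm.trans h2.1)
    · intro k _
      exact (hN.measurable_tier n (measurableSet_singleton k)).inter
        (hN.measurable_mark n (measurable_prodMk_left hs))

lemma lintegral_palm (hN : N.IsPoissonNetwork P lam p ν γ) (B : Set Plane)
    {f : Ω → ℝ≥0∞} (hf : Measurable f) :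
    ∫⁻ ω, f ω ∂(N.palm P lam B) = (ENNReal.ofReal lam * volume B)⁻¹ *
      ∑' n, ∫⁻ ω in N.T n ⁻¹' B, f (N.θ (N.T n ω) ω) ∂P := by
  rw [palm, lintegral_smul_measure, lintegral_sum_measure, smul_eq_mul]
  congr 2 with n
  exact lintegral_map hf (hN.flow.measurable.comp ((hN.poisson.measurable n).prodMk measurable_id))

variable [IsProbabilityMeasure P]

/-- By distinctness, the configuration seen from point n has a tier-i point at the origin exactly
when point n is of tier i. The sum is then the mean number p_i λ|B| of such points in B, so
conditioning amounts to restricting and dividing by p_i. -/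
lemma palm_tierAtOrigin [∀ k, IsProbabilityMeasure (ν k)]
    (hN : N.IsPoissonNetwork P lam p ν γ) (hlam : 0 < lam) {B : Set Plane}
    (hB : MeasurableSet B) (hB0 : volume B ≠ 0) (hB' : volume B ≠ ∞) (i : Fin K) :
    N.palm P lam B (N.tierAtOrigin i) = ENNReal.ofReal (p i) := by
  have hMP := hN.isMarkedPoisson
  have := hMP.isProbabilityMeasure
  have hE := hN.measurableSet_tierAtOrigin i
  rw [← lintegral_indicator_one hE, hN.lintegral_palm B (measurable_one.indicator hE)]
  have hterm (n : ℕ) : ∫⁻ ω in N.T n ⁻¹' B, (N.tierAtOrigin i).indicator 1 (N.θ (N.T n ω) ω) ∂P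
      = P {ω | (N.T n ω, (N.tier n ω, N.mark n ω)) ∈ B ×ˢ ({i} ×ˢ univ)} := by
    have hm : MeasurableSet (N.tier n ⁻¹' {i}) := hN.measurable_tier n (measurableSet_singleton i)
    have : ∫⁻ ω in N.T n ⁻¹' B, (N.tierAtOrigin i).indicator 1 (N.θ (N.T n ω) ω) ∂P
        = ∫⁻ ω in N.T n ⁻¹' B, (N.tier n ⁻¹' {i}).indicator 1 ω ∂P := by
      refine lintegral_congr_ae (ae_restrict_of_ae ?_)
      filter_upwards [hMP.ae_injective hlam] with ω hω
      refine indicator_eq_indicator ?_ rfl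
      rw [mem_tierAtOrigin_flow hN.compatible]
      exact ⟨fun ⟨m, hm, hi⟩ => (hω hm) ▸ hi, fun hi => ⟨n, rfl, hi⟩⟩
    rw [this, lintegral_indicator_one hm, Measure.restrict_apply hm]
    congr 1
    ext ω
    simp [and_comm]
  simp_rw [hterm]
  rw [hMP.tsum_measure_mem hlam (hB.prod ((measurableSet_singleton i).prod MeasurableSet.univ)),
    Measure.prod_prod, Measure.smul_apply, smul_eq_mul, ← mul_assoc, ENNReal.inv_mul_cancel,
    one_mul, ← hMP.law 0, Measure.map_apply (hMP.measurable_mark 0)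
      ((measurableSet_singleton i).prod MeasurableSet.univ)]
  · have := hN.mark_law 0 i univ MeasurableSet.univ
    rw [measure_univ, mul_one] at this
    rw [← this]
    congr 1
  · exact mul_ne_zero (by simpa using hlam) hB0
  · exact ENNReal.mul_ne_top ENNReal.ofReal_ne_top hB'

/-- The mean cell area through the expected number of access points in `B` serving a location. -/
lemma meanCellArea_eq_lintegral [∀ k, IsProbabilityMeasure (ν k)]
    (hN : N.IsPoissonNetwork P lam p ν γ) (hlam : 0 < lam) {B : Set Plane}
    (hB : MeasurableSet B) (hB0 : volume B ≠ 0) (hB' : volume B ≠ ∞) (i : Fin K) :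
    N.meanCellArea P lam B i = (ENNReal.ofReal (p i))⁻¹ * ((ENNReal.ofReal lam * volume B)⁻¹ *
      ∫⁻ y, ∑' n, P {ω | (N.T n ω, (N.tier n ω, N.mark n ω)) ∈
          {x | x.1 ∈ B ∧ x.2.1 = i ∧ N.score y x ≠ 0} ∧
        ∀ m, m ≠ n → N.score y (N.T m ω, (N.tier m ω, N.mark m ω))
          < N.score y (N.T n ω, (N.tier n ω, N.mark n ω))}) := by
  have hMP := hN.isMarkedPoisson
  have hE := hN.measurableSet_tierAtOrigin i
  rw [meanCellArea, ProbabilityTheory.cond, lintegral_smul_measure, smul_eq_mul,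
    hN.palm_tierAtOrigin hlam hB hB0 hB', ← lintegral_indicator hE,
    hN.lintegral_palm B (hN.measurable_volume_cell.indicator hE)]
  congr 2
  let W : ℕ → Set (Ω × Plane) := fun n => (Prod.fst ⁻¹' (N.T n ⁻¹' B ∩ N.tier n ⁻¹' {i})) ∩
    {q : Ω × Plane | ∀ m, m ≠ n → N.received m q.1 q.2 < N.received n q.1 q.2}
  have hT (n : ℕ) : MeasurableSet (N.T n ⁻¹' B) := hN.poisson.measurable n hB
  have hti (n : ℕ) : MeasurableSet (N.tier n ⁻¹' {i}) :=
    hN.measurable_tier n (measurableSet_singleton i)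
  have hW (n : ℕ) : MeasurableSet (W n) :=
    (measurable_fst ((hT n).inter (hti n))).inter (hN.measurableSet_strictMax n)
  have hleft (n : ℕ) : ∫⁻ ω in N.T n ⁻¹' B, (N.tierAtOrigin i).indicator
      (fun ω => volume (N.cell ω 0)) (N.θ (N.T n ω) ω) ∂P = (P.prod volume) (W n) := by
    rw [Measure.prod_apply (hW n), ← lintegral_indicator (hT n)]
    refine lintegral_congr_ae ?_
    filter_upwards [hMP.ae_injective hlam] with ω hω
    by_cases hωB : ω ∈ N.T n ⁻¹' B
    · rw [indicator_of_mem hωB]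
      have hiff : N.θ (N.T n ω) ω ∈ N.tierAtOrigin i ↔ N.tier n ω = i := by
        rw [mem_tierAtOrigin_flow hN.compatible]
        exact ⟨fun ⟨m, hm, hi⟩ => (hω hm) ▸ hi, fun hi => ⟨n, rfl, hi⟩⟩
      by_cases hi : N.tier n ω = i
      · rw [indicator_of_mem (hiff.2 hi), volume_cell_flow hN.compatible, cell_of_injective hω]
        congr 1
        ext y
        have : N.T n ω ∈ B := hωB
        simp [W, this, hi]
      · rw [indicator_of_notMem (mt hiff.1 hi)]
        have : Prod.mk ω ⁻¹' W n = ∅ := by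
          ext y
          simp [W, hi]
        rw [this, measure_empty]
    · rw [indicator_of_notMem hωB]
      have : Prod.mk ω ⁻¹' W n = ∅ := by
        ext y
        have : N.T n ω ∉ B := hωB
        simp [W, this]
      rw [this, measure_empty]
  simp_rw [hleft]
  have hright (n : ℕ) (y : Plane) : P {ω | (N.T n ω, (N.tier n ω, N.mark n ω)) ∈
        {x | x.1 ∈ B ∧ x.2.1 = i ∧ N.score y x ≠ 0} ∧
      ∀ m, m ≠ n → N.score y (N.T m ω, (N.tier m ω, N.mark m ω))
        < N.score y (N.T n ω, (N.tier n ω, N.mark n ω))} = P ((fun ω => (ω, y)) ⁻¹' W n) := by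
    congr 1
    ext ω
    simp only [W, mem_ofPred_eq, mem_preimage, mem_inter_iff, mem_singleton_iff,
      received_eq_score]
    constructor
    · rintro ⟨⟨h1, h2, -⟩, h3⟩
      exact ⟨⟨h1, h2⟩, h3⟩
    · rintro ⟨⟨h1, h2⟩, h3⟩
      exact ⟨⟨h1, h2, (bot_le.trans_lt (h3 (n + 1) n.succ_ne_self)).ne'⟩, h3⟩
  simp_rw [hright]
  rw [lintegral_tsum fun n => (measurable_measure_prodMk_right (hW n)).aemeasurable]
  congr 1 with n
  rw [Measure.prod_apply_symm (hW n)]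

end IsPoissonNetwork

end HetNet

end Network

/-! ### Intensity of the points received above a threshold. -/

section ScoreIntensity

open Filter Topology

/-- The set is the closed disc of radius (c/s)^(1/a) about y; its centre belongs to it because
0^(-a) = ∞. -/
lemma volume_le_mul_edist_rpow (y : Plane) {c s a : ℝ} (hc : 0 < c) (hs : 0 < s) (ha : 0 < a) :
    volume {x : Plane | ENNReal.ofReal s ≤ ENNReal.ofReal c * edist x y ^ (-a)}
      = ENNReal.ofReal (Real.pi * (c / s) ^ (2 / a)) := by
  have hset : {x : Plane | ENNReal.ofReal s ≤ ENNReal.ofReal c * edist x y ^ (-a)}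
      = Metric.closedBall y ((c / s) ^ a⁻¹) := by
    ext x
    rw [mem_ofPred_eq, Metric.mem_closedBall, ← edist_le_ofReal (by positivity),
      ← ENNReal.ofReal_rpow_of_pos (by positivity), ENNReal.le_rpow_inv_iff ha,
      ENNReal.rpow_neg, ← div_eq_mul_inv, ENNReal.ofReal_div_of_pos hs,
      ENNReal.le_div_iff_mul_le (Or.inr (by simpa using hc)) (Or.inr ENNReal.ofReal_ne_top),
      ENNReal.le_div_iff_mul_le (Or.inr (by simpa using hc)) (Or.inr ENNReal.ofReal_ne_top),
      mul_comm]
  rw [hset, EuclideanSpace.volume_closedBall_fin_two, ← ENNReal.ofReal_pow (by positivity),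
    ← ENNReal.ofReal_mul (by positivity), mul_comm, ← Real.rpow_natCast, ← Real.rpow_mul (by positivity)]
  congr 3
  push_cast
  field_simp

variable {Ω M : Type*} {K : ℕ} [MeasurableSpace M]

lemma gainMoment_pos {γ : Measure ℝ≥0} [IsProbabilityMeasure γ] (hpos : ∀ᵐ h ∂γ, 0 < h) {s : ℝ}
    (hint : Integrable (fun h : ℝ≥0 => (h : ℝ) ^ s) γ) : 0 < gainMoment γ s := by
  rw [gainMoment, integral_pos_iff_support_of_nonneg (fun h => by positivity) hint]
  have : (Function.support fun h : ℝ≥0 => (h : ℝ) ^ s) =ᵐ[γ] univ := by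
    filter_upwards [hpos] with h hh
    refine propext (iff_true_intro ?_)
    have : (0 : ℝ) < (h : ℝ) := hh
    exact (Real.rpow_pos_of_pos this s).ne'
  rw [measure_congr this, measure_univ]
  exact one_pos

/-- The intensity, up to the factor `s ^ (-2 / a)`, of the access points of a given tier received
with power at least `s`. -/
lemma lintegral_measure_score_ge {γ : Measure ℝ≥0} (hpos : ∀ᵐ h ∂γ, 0 < h)
    {q s a : ℝ} (hq : 0 < q) (hs : 0 < s) (ha : 0 < a)
    (hint : Integrable (fun h : ℝ≥0 => (h : ℝ) ^ (2 / a)) γ) (y : Plane) :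
    ∫⁻ h : ℝ≥0, volume {x : Plane | ENNReal.ofReal s ≤
        ENNReal.ofReal q * (h : ℝ≥0∞) * edist x y ^ (-a)} ∂γ
      = ENNReal.ofReal (Real.pi * (q ^ (2 / a) * gainMoment γ (2 / a) * s ^ (-(2 / a)))) := by
  have h1 : ∫⁻ h : ℝ≥0, volume {x : Plane | ENNReal.ofReal s ≤
        ENNReal.ofReal q * (h : ℝ≥0∞) * edist x y ^ (-a)} ∂γ
      = ∫⁻ h : ℝ≥0, ENNReal.ofReal (Real.pi * q ^ (2 / a) * s ^ (-(2 / a)) * (h : ℝ) ^ (2 / a)) ∂γ := by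
    refine lintegral_congr_ae ?_
    filter_upwards [hpos] with h hh
    have hh' : (0 : ℝ) < (h : ℝ) := hh
    have : ENNReal.ofReal q * (h : ℝ≥0∞) = ENNReal.ofReal (q * h) := by
      rw [ENNReal.ofReal_mul hq.le, ENNReal.ofReal_coe_nnreal]
    rw [this, volume_le_mul_edist_rpow y (mul_pos hq hh') hs ha, Real.div_rpow (by positivity) hs.le,
      Real.mul_rpow hq.le hh'.le, Real.rpow_neg hs.le]
    congr 1
    ring
  rw [h1, ← ofReal_integral_eq_lintegral_ofReal (hint.const_mul _)
    (ae_of_all _ fun h => by positivity), integral_const_mul, gainMoment]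
  congr 1
  ring

namespace HetNet.IsPoissonNetwork

variable [MeasurableSpace Ω] {P : Measure Ω} {N : HetNet Ω M K} {lam : ℝ} {p : Fin K → ℝ}
  {ν : Fin K → Measure M} {γ : Fin K → Measure ℝ≥0}
  [∀ k, IsProbabilityMeasure (γ k)] [IsProbabilityMeasure P]

/-- The intensity of the access points received at `y` with power at least `s`. -/
lemma intensity_score_ge (hN : N.IsPoissonNetwork P lam p ν γ) (hlam : 0 < lam)
    (hp : ∀ k, 0 ≤ p k) [∀ k, IsProbabilityMeasure (ν k)]
    (hpow : ∀ k, 0 < N.pow k) (hple : ∀ k, 0 < N.ple k) (hpos : ∀ k, ∀ᵐ h ∂(γ k), 0 < h)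
    (hmom : ∀ k, Integrable (fun h : ℝ≥0 => (h : ℝ) ^ (2 / N.ple k)) (γ k))
    {lamt : Fin K → ℝ} (hlamt : ∀ k, lamt k =
      (p k * lam) * (N.pow k : ℝ) ^ (2 / N.ple k) * gainMoment (γ k) (2 / N.ple k))
    (y : Plane) {s : ℝ} (hs : 0 < s) :
    ((ENNReal.ofReal lam • volume).prod (markLaw p ν)) {x | ENNReal.ofReal s ≤ N.score y x}
      = ENNReal.ofReal (Real.pi * ∑ k, lamt k * s ^ (-(2 / N.ple k))) := by
  have := hN.isMarkedPoisson.isProbabilityMeasure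
  have hsc : Measurable (N.score y) :=
    (measurable_score hN.measurable_fading).comp measurable_prodMk_left
  have hset : MeasurableSet {x | ENNReal.ofReal s ≤ N.score y x} := hsc measurableSet_Ici
  have hg (k : Fin K) : 0 < gainMoment (γ k) (2 / N.ple k) := gainMoment_pos (hpos k) (hmom k)
  have hpw (k : Fin K) : (0 : ℝ) < N.pow k := hpow k
  let F : Fin K → Set (Plane × ℝ≥0) := fun k => {q | ENNReal.ofReal s ≤
    ENNReal.ofReal (N.pow k) * (q.2 : ℝ≥0∞) * edist q.1 y ^ (-(N.ple k))}
  have hF (k : Fin K) : MeasurableSet (F k) := by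
    refine measurableSet_le measurable_const ?_
    fun_prop
  -- Over a fixed x the score uses the random field only at y - x, where its law is γ k whatever x
  -- is. The field can thus be replaced by a gain independent of x, and Fubini then integrates over
  -- x first.
  have hfib (x : Plane) : markLaw p ν (Prod.mk x ⁻¹' {x | ENNReal.ofReal s ≤ N.score y x})
      = ∑ k, ENNReal.ofReal (p k) * γ k (Prod.mk x ⁻¹' F k) := by
    have hset' := measurable_prodMk_left (x := x) hset
    rw [← lintegral_indicator_one hset', lintegral_markLaw p ν (measurable_one.indicator hset')]
    refine Finset.sum_congr rfl fun k _ => ?_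
    congr 1
    have hfm : Measurable fun m => N.fading m (y - x) :=
      hN.measurable_fading.comp measurable_prodMk_right
    rw [← hN.gain_law k (y - x), Measure.map_apply hfm (measurable_prodMk_left (hF k))]
    refine Eq.trans ?_ (lintegral_indicator_one (hfm (measurable_prodMk_left (hF k))))
    refine lintegral_congr fun m => ?_
    refine indicator_eq_indicator ?_ rfl
    simp only [F, score, mem_preimage, mem_ofPred_eq, ENNReal.ofReal_coe_nnreal]
  rw [Measure.prod_apply hset]
  simp_rw [hfib]
  rw [lintegral_smul_measure, lintegral_finsetSum _ fun k _ =>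
    (measurable_measure_prodMk_left (hF k)).const_mul _]
  have hk (k : Fin K) : ∫⁻ x, ENNReal.ofReal (p k) * γ k (Prod.mk x ⁻¹' F k)
      = ENNReal.ofReal (p k * (Real.pi * ((N.pow k : ℝ) ^ (2 / N.ple k)
        * gainMoment (γ k) (2 / N.ple k) * s ^ (-(2 / N.ple k))))) := by
    rw [lintegral_const_mul _ (measurable_measure_prodMk_left (hF k)),
      ← Measure.prod_apply (μ := volume) (hF k), Measure.prod_apply_symm (hF k),
      ENNReal.ofReal_mul (hp k), ← lintegral_measure_score_ge (hpos k) (hpw k) hs (hple k) (hmom k) y]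
    rfl
  simp_rw [hk]
  rw [smul_eq_mul, ← ENNReal.ofReal_sum_of_nonneg, ← ENNReal.ofReal_mul hlam.le, Finset.mul_sum,
    Finset.mul_sum]
  · congr 1
    refine Finset.sum_congr rfl fun k _ => ?_
    rw [hlamt]
    ring
  · intro k _
    have := (hg k).le
    have := hp k
    positivity

end HetNet.IsPoissonNetwork

end ScoreIntensity

/-! ### Coverage integrals and the mean cell area. -/

section MeanCellArea

open Filter Topology

variable {K : ℕ}

/-- The probability that no access point is received with more power than one of power `q` and path
loss exponent `a` at distance `r` with gain `h`. -/
noncomputable def coverage (lamt b : Fin K → ℝ) (q a r : ℝ) (h : ℝ≥0) : ℝ :=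
  Real.exp (-(Real.pi * ∑ k, lamt k * r ^ (2 * a / b k) * (q * (h : ℝ)) ^ (-(2 / b k))))

variable (lamt b : Fin K → ℝ) (q a : ℝ)

lemma measurable_coverage :
    Measurable fun x : ℝ × ℝ≥0 => coverage lamt b q a x.1 x.2 := by
  unfold coverage
  fun_prop

variable {lamt}

lemma coverage_le_one (hlamt : ∀ k, 0 ≤ lamt k) (hq : 0 ≤ q) {r : ℝ} (hr : 0 ≤ r) (h : ℝ≥0) :
    coverage lamt b q a r h ≤ 1 := by
  refine Real.exp_le_one_iff.2 (neg_nonpos.2 (mul_nonneg Real.pi_pos.le ?_))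
  refine Finset.sum_nonneg fun k _ => mul_nonneg (mul_nonneg (hlamt k) ?_) ?_ <;> positivity

lemma rpow_neg_mul_rpow {c r e : ℝ} (hc : 0 < c) (hr : 0 < r) :
    (c * r ^ (-a)) ^ (-(2 / e)) = r ^ (2 * a / e) * c ^ (-(2 / e)) := by
  rw [Real.mul_rpow hc.le (by positivity), ← Real.rpow_mul hr.le, mul_comm]
  congr 2
  ring

lemma lintegral_gaussian {c : ℝ} (hc : 0 < c) :
    ∫⁻ z : Plane, ENNReal.ofReal (Real.exp (-(Real.pi * (c * ‖z‖ ^ 2))))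
      = ENNReal.ofReal c⁻¹ := by
  have h := GaussianFourier.integral_rexp_neg_mul_sq_norm (V := Plane) (b := Real.pi * c)
    (by positivity)
  have h1 : (Real.pi / (Real.pi * c)) ^ (Module.finrank ℝ Plane / 2 : ℝ) = c⁻¹ := by
    have : Module.finrank ℝ Plane = 2 := by simp
    rw [this]
    norm_num
    field_simp
  rw [h1] at h
  have hint : Integrable fun z : Plane => Real.exp (-(Real.pi * c) * ‖z‖ ^ 2) := by
    -- A non-integrable function would have integral 0 by convention, against the positive value
    -- c⁻¹.
    by_contra hcon
    rw [integral_undef hcon] at h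
    exact (inv_pos.2 hc).ne h
  rw [← h, ofReal_integral_eq_lintegral_ofReal hint (ae_of_all _ fun z => (Real.exp_pos _).le)]
  refine lintegral_congr fun z => ?_
  congr 2
  ring

/-- A Gaussian integral averaged over a random gain. -/
lemma lintegral_lintegral_gaussian {γ : Measure ℝ≥0} {c e : ℝ} (hc : 0 < c)
    (hq : 0 < q) (hpos : ∀ᵐ h ∂γ, 0 < h) (hint : Integrable (fun h : ℝ≥0 => (h : ℝ) ^ e) γ) :
    ∫⁻ h : ℝ≥0, (∫⁻ z : Plane, ENNReal.ofReal
        (Real.exp (-(Real.pi * (c * ‖z‖ ^ 2 * (q * (h : ℝ)) ^ (-e)))))) ∂γ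
      = ENNReal.ofReal (q ^ e * gainMoment γ e / c) := by
  have h1 : ∫⁻ h : ℝ≥0, (∫⁻ z : Plane, ENNReal.ofReal
        (Real.exp (-(Real.pi * (c * ‖z‖ ^ 2 * (q * (h : ℝ)) ^ (-e)))))) ∂γ
      = ∫⁻ h : ℝ≥0, ENNReal.ofReal (q ^ e / c * (h : ℝ) ^ e) ∂γ := by
    refine lintegral_congr_ae ?_
    filter_upwards [hpos] with h hh
    have hh' : (0 : ℝ) < (h : ℝ) := hh
    have hcc : 0 < c * (q * (h : ℝ)) ^ (-e) := by positivity
    have := lintegral_gaussian hcc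
    rw [mul_inv, Real.rpow_neg (by positivity), inv_inv, Real.mul_rpow hq.le hh'.le] at this
    rw [show q ^ e / c * (h : ℝ) ^ e = c⁻¹ * (q ^ e * (h : ℝ) ^ e) by ring, ← this]
    refine lintegral_congr fun z => ?_
    rw [Real.rpow_neg (by positivity), Real.mul_rpow hq.le hh'.le, mul_right_comm]
  rw [h1, ← ofReal_integral_eq_lintegral_ofReal (hint.const_mul _)
    (ae_of_all _ fun h => by positivity), integral_const_mul, gainMoment]
  congr 1
  ring

lemma lintegral_coverage_swap (γ : Measure ℝ≥0) [IsProbabilityMeasure γ] :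
    ∫⁻ z : Plane, ∫⁻ h, ENNReal.ofReal (coverage lamt b q a ‖z‖ h) ∂γ
      = ∫⁻ h, (∫⁻ z : Plane, ENNReal.ofReal (coverage lamt b q a ‖z‖ h)) ∂γ := by
  refine lintegral_lintegral_swap ?_
  have := (measurable_coverage lamt b q a).comp
    (f := fun x : Plane × ℝ≥0 => (‖x.1‖, x.2)) (by fun_prop)
  exact this.ennreal_ofReal.aemeasurable

/-- Keeping only the term k = i, where the exponent of the distance is exactly 2, bounds the
coverage by a Gaussian. Its average over the gain is finite by the moment hypothesis. -/
lemma lintegral_coverage_ne_top {γ : Measure ℝ≥0} [IsProbabilityMeasure γ]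
    (hlamt : ∀ k, 0 ≤ lamt k) (hq : 0 < q) {i : Fin K} (hi : 0 < lamt i) (hb : b i ≠ 0)
    (hpos : ∀ᵐ h ∂γ, 0 < h) (hint : Integrable (fun h : ℝ≥0 => (h : ℝ) ^ (2 / b i)) γ) :
    ∫⁻ z : Plane, ∫⁻ h, ENNReal.ofReal (coverage lamt b q (b i) ‖z‖ h) ∂γ ≠ ∞ := by
  rw [lintegral_coverage_swap]
  refine ne_top_of_le_ne_top ((lintegral_lintegral_gaussian q hi hq hpos hint).trans_ne
    ENNReal.ofReal_ne_top) (lintegral_mono fun h => lintegral_mono fun z => ?_)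
  refine ENNReal.ofReal_le_ofReal (Real.exp_le_exp.2 (neg_le_neg ?_))
  refine mul_le_mul_of_nonneg_left ?_ Real.pi_pos.le
  have hterm : lamt i * ‖z‖ ^ 2 * (q * (h : ℝ)) ^ (-(2 / b i))
      = lamt i * ‖z‖ ^ (2 * b i / b i) * (q * (h : ℝ)) ^ (-(2 / b i)) := by
    rw [mul_div_cancel_right₀ _ hb]
    norm_num
  rw [hterm]
  refine Finset.single_le_sum (f := fun k => lamt k * ‖z‖ ^ (2 * b i / b k)
    * (q * (h : ℝ)) ^ (-(2 / b k))) (fun k _ => ?_) (Finset.mem_univ i)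
  have := hlamt k
  positivity

/-- With equal path loss exponents the coverage integral is explicit. -/
lemma lintegral_coverage_of_const {γ : Measure ℝ≥0} [IsProbabilityMeasure γ]
    (hq : 0 < q) (hsum : 0 < ∑ k, lamt k) (ha : a ≠ 0) (hb : ∀ k, b k = a)
    (hpos : ∀ᵐ h ∂γ, 0 < h) (hint : Integrable (fun h : ℝ≥0 => (h : ℝ) ^ (2 / a)) γ) :
    ∫⁻ z : Plane, ∫⁻ h, ENNReal.ofReal (coverage lamt b q a ‖z‖ h) ∂γ
      = ENNReal.ofReal (q ^ (2 / a) * gainMoment γ (2 / a) / ∑ k, lamt k) := by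
  rw [lintegral_coverage_swap, ← lintegral_lintegral_gaussian q hsum hq hpos hint]
  refine lintegral_congr fun h => lintegral_congr fun z => ?_
  simp only [coverage, hb, mul_div_cancel_right₀ _ ha, Real.rpow_two, Finset.sum_mul]

/-- Polar coordinates for the coverage integral. -/
lemma integrableOn_and_lintegral_coverage {γ : Measure ℝ≥0} [IsProbabilityMeasure γ]
    (hlamt : ∀ k, 0 ≤ lamt k) (hq : 0 ≤ q)
    (hfin : ∫⁻ z : Plane, ∫⁻ h, ENNReal.ofReal (coverage lamt b q a ‖z‖ h) ∂γ ≠ ∞) :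
    IntegrableOn (fun r : ℝ => r * ∫ h, coverage lamt b q a r h ∂γ) (Ioi 0) ∧
    ∫⁻ z : Plane, ∫⁻ h, ENNReal.ofReal (coverage lamt b q a ‖z‖ h) ∂γ
      = ENNReal.ofReal (2 * Real.pi * ∫ r in Ioi (0 : ℝ), r * ∫ h, coverage lamt b q a r h ∂γ) := by
  let φ : ℝ → ℝ := fun r => ∫ h, coverage lamt b q a r h ∂γ
  have hm := measurable_coverage lamt b q a
  have hφm : Measurable φ := (hm.stronglyMeasurable.integral_prod_right (ν := γ)).measurable
  have hnn (r : ℝ) (h : ℝ≥0) : 0 ≤ coverage lamt b q a r h := (Real.exp_pos _).le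
  have hφ0 (r : ℝ) : 0 ≤ φ r := integral_nonneg (hnn r)
  have hφ (z : Plane) : ∫⁻ h, ENNReal.ofReal (coverage lamt b q a ‖z‖ h) ∂γ
      = ENNReal.ofReal (φ ‖z‖) := by
    refine (ofReal_integral_eq_lintegral_ofReal ?_ (ae_of_all _ (hnn _))).symm
    refine Integrable.of_bound (C := 1) (hm.comp measurable_prodMk_left).aestronglyMeasurable
      (ae_of_all _ fun h => ?_)
    rw [Real.norm_of_nonneg (hnn _ _)]
    exact coverage_le_one b q a hlamt hq (norm_nonneg z) h
  simp_rw [hφ] at hfin ⊢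
  have hint : Integrable fun z : Plane => φ ‖z‖ := by
    refine ⟨(hφm.comp measurable_norm).aestronglyMeasurable, ?_⟩
    rw [hasFiniteIntegral_iff_ofReal (ae_of_all _ fun z => hφ0 _)]
    exact lt_top_iff_ne_top.2 hfin
  have hrank : Module.finrank ℝ Plane = 2 := by simp
  -- The polar constant 2π arises as the dimension times the area of the unit disc.
  have hball : (volume : Measure Plane).real (Metric.ball 0 1) = Real.pi := by
    rw [measureReal_def, EuclideanSpace.volume_ball_fin_two]
    simp [Real.pi_pos.le]
  constructor
  · have := (integrable_fun_norm_addHaar (volume : Measure Plane)).1 hint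
    rw [hrank] at this
    simpa using this
  · rw [← ofReal_integral_eq_lintegral_ofReal hint (ae_of_all _ fun z => hφ0 _),
      integral_fun_norm_addHaar, hrank, hball]
    simp [φ, mul_assoc]

variable {Ω M : Type*} [MeasurableSpace M] [MeasurableSpace Ω]

namespace HetNet.IsPoissonNetwork

variable {P : Measure Ω} {N : HetNet Ω M K} {lam : ℝ} {p : Fin K → ℝ}
  {ν : Fin K → Measure M} {γ : Fin K → Measure ℝ≥0}
  [∀ k, IsProbabilityMeasure (γ k)] [IsProbabilityMeasure P]

/-- Conditionally on an access point of tier `i` at `x`, the probability that it serves `y`. -/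
lemma lintegral_expNeg_intensity (hN : N.IsPoissonNetwork P lam p ν γ) (hlam : 0 < lam)
    (hp : ∀ k, 0 ≤ p k) [∀ k, IsProbabilityMeasure (ν k)]
    (hpow : ∀ k, 0 < N.pow k) (hple : ∀ k, 0 < N.ple k) (hpos : ∀ k, ∀ᵐ h ∂(γ k), 0 < h)
    (hmom : ∀ k, Integrable (fun h : ℝ≥0 => (h : ℝ) ^ (2 / N.ple k)) (γ k))
    (hlamt : ∀ k, lamt k =
      (p k * lam) * (N.pow k : ℝ) ^ (2 / N.ple k) * gainMoment (γ k) (2 / N.ple k))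
    (i : Fin K) {x y : Plane} (hxy : x ≠ y) :
    ∫⁻ m, {m | N.score y (x, (i, m)) ≠ 0}.indicator (fun m =>
        expNeg (((ENNReal.ofReal lam • volume).prod (markLaw p ν))
          {w | N.score y (x, (i, m)) ≤ N.score y w})) m ∂(ν i)
      = ∫⁻ h, ENNReal.ofReal (coverage lamt N.ple (N.pow i) (N.ple i) ‖y - x‖ h) ∂(γ i) := by
  have hfm : Measurable fun m => N.fading m (y - x) :=
    hN.measurable_fading.comp measurable_prodMk_right
  have hcov : Measurable fun h =>
      ENNReal.ofReal (coverage lamt N.ple (N.pow i) (N.ple i) ‖y - x‖ h) :=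
    ((measurable_coverage lamt N.ple (N.pow i) (N.ple i)).comp measurable_prodMk_left).ennreal_ofReal
  rw [← hN.gain_law i (y - x), lintegral_map hcov hfm]
  have hpos' := hpos i
  rw [← hN.gain_law i (y - x)] at hpos'
  refine lintegral_congr_ae ?_
  filter_upwards [ae_of_ae_map hfm.aemeasurable hpos'] with m hm
  have hr : 0 < ‖y - x‖ := norm_pos_iff.2 (sub_ne_zero.2 hxy.symm)
  have hh : (0 : ℝ) < N.fading m (y - x) := hm
  have hq : (0 : ℝ) < N.pow i := hpow i
  have hs : N.score y (x, (i, m))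
      = ENNReal.ofReal ((N.pow i * N.fading m (y - x)) * ‖y - x‖ ^ (-(N.ple i))) := by
    rw [ENNReal.ofReal_mul (by positivity), ENNReal.ofReal_mul hq.le,
      ← ENNReal.ofReal_rpow_of_pos hr, ENNReal.ofReal_coe_nnreal, ENNReal.ofReal_coe_nnreal,
      ← dist_eq_norm, dist_comm, ← edist_dist]
    rfl
  have hs0 : 0 < (N.pow i * N.fading m (y - x)) * ‖y - x‖ ^ (-(N.ple i)) := by positivity
  rw [indicator_of_mem (by
    change N.score y (x, (i, m)) ≠ 0
    rw [hs]
    simpa using hs0), hs, hN.intensity_score_ge hlam hp hpow hple hpos hmom hlamt y hs0, expNeg,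
    ENNReal.toReal_ofReal]
  · unfold coverage
    congr 4
    refine Finset.sum_congr rfl fun k _ => ?_
    rw [rpow_neg_mul_rpow _ (mul_pos hq hh) hr, mul_assoc]
  · refine mul_nonneg Real.pi_pos.le (Finset.sum_nonneg fun k _ => mul_nonneg ?_ (by positivity))
    rw [hlamt]
    have := (gainMoment_pos (hpos k) (hmom k)).le
    have := hp k
    positivity

/-- The chance that a tier-i point at x serves y depends only on y - x. Its integral over y is thus
the same for every x in B, and the normalization p_i λ|B| cancels. -/
theorem meanCellArea_eq_lintegral_coverage (hN : N.IsPoissonNetwork P lam p ν γ) (hlam : 0 < lam)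
    (hp : ∀ k, 0 ≤ p k) [∀ k, IsProbabilityMeasure (ν k)]
    (hpow : ∀ k, 0 < N.pow k) (hple : ∀ k, 0 < N.ple k) (hpos : ∀ k, ∀ᵐ h ∂(γ k), 0 < h)
    (hmom : ∀ k, Integrable (fun h : ℝ≥0 => (h : ℝ) ^ (2 / N.ple k)) (γ k))
    (hlamt : ∀ k, lamt k =
      (p k * lam) * (N.pow k : ℝ) ^ (2 / N.ple k) * gainMoment (γ k) (2 / N.ple k))
    (i : Fin K) (hi : 0 < p i) {B : Set Plane} (hB : MeasurableSet B) (hB0 : volume B ≠ 0)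
    (hB' : volume B ≠ ∞) :
    N.meanCellArea P lam B i = ∫⁻ z : Plane, ∫⁻ h,
      ENNReal.ofReal (coverage lamt N.ple (N.pow i) (N.ple i) ‖z‖ h) ∂(γ i) := by
  have hMP := hN.isMarkedPoisson
  have := hMP.isProbabilityMeasure
  set φ : Plane → ℝ≥0∞ := fun z => ∫⁻ h,
    ENNReal.ofReal (coverage lamt N.ple (N.pow i) (N.ple i) ‖z‖ h) ∂(γ i)
  have hφ : Measurable φ := by
    have := (measurable_coverage lamt N.ple (N.pow i) (N.ple i)).comp
      (f := fun x : Plane × ℝ≥0 => (‖x.1‖, x.2)) (by fun_prop)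
    exact this.ennreal_ofReal.lintegral_prod_right'
  set Λ := (ENNReal.ofReal lam • (volume : Measure Plane)).prod (markLaw p ν)
  have hsc (y : Plane) : Measurable (N.score y) :=
    (measurable_score hN.measurable_fading).comp measurable_prodMk_left
  have hfin (y : Plane) (s : ℝ≥0∞) (hs0 : s ≠ 0) (hs : s ≠ ∞) : Λ {x | s ≤ N.score y x} ≠ ∞ := by
    have := hN.intensity_score_ge hlam hp hpow hple hpos hmom hlamt y
      (ENNReal.toReal_pos hs0 hs)
    rw [ENNReal.ofReal_toReal hs] at this
    exact this.trans_ne ENNReal.ofReal_ne_top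
  let A : Plane → Set (Plane × (Fin K × M)) := fun y =>
    {x | x.1 ∈ B ∧ x.2.1 = i ∧ N.score y x ≠ 0}
  have hA (y : Plane) : MeasurableSet (A y) :=
    (measurable_fst hB).inter (((measurable_fst.comp measurable_snd)
      (measurableSet_singleton i)).inter (hsc y (measurableSet_singleton 0).compl))
  have hinner (y : Plane) : ∫⁻ x in A y, expNeg (Λ {w | N.score y x ≤ N.score y w}) ∂Λ
      = ENNReal.ofReal lam * ENNReal.ofReal (p i) * ∫⁻ x in B, φ (y - x) := by
    have hem : Measurable fun x => expNeg (Λ {w | N.score y x ≤ N.score y w}) := by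
      -- The tail intensity is monotone in the threshold, hence measurable.
      have hanti : Antitone fun s : ℝ≥0∞ => Λ {w | s ≤ N.score y w} :=
        fun s t hst => measure_mono fun w hw => hst.trans hw
      exact measurable_expNeg.comp (hanti.measurable.comp (hsc y))
    have hind := hem.indicator (hA y)
    rw [← lintegral_indicator (hA y), lintegral_prod _ hind.aemeasurable, lintegral_smul_measure,
      smul_eq_mul, mul_assoc]
    congr 1
    have hφy : Measurable fun x => φ (y - x) := hφ.comp (measurable_const.sub measurable_id)
    rw [← lintegral_indicator hB, ← lintegral_const_mul _ (hφy.indicator hB)]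
    refine lintegral_congr_ae ?_
    -- At x = y the score may be infinite; a single location is negligible.
    have hne : ∀ᵐ x : Plane, x ≠ y := by
      rw [ae_iff]
      simp
    filter_upwards [hne] with x hx
    rw [lintegral_markLaw p ν (f := fun z => (A y).indicator
      (fun x => expNeg (Λ {w | N.score y x ≤ N.score y w})) (x, z))
      (hind.comp measurable_prodMk_left), Finset.sum_eq_single i]
    · congr 1
      by_cases hxB : x ∈ B
      · rw [indicator_of_mem hxB]
        refine Eq.trans ?_ (hN.lintegral_expNeg_intensity hlam hp hpow hple hpos hmom hlamt i hx)
        refine lintegral_congr fun m => ?_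
        simp [indicator, A, hxB, Λ]
      · rw [indicator_of_notMem hxB]
        simp [indicator, A, hxB]
    · intro k _ hk
      simp [indicator, A, hk]
    · simp
  rw [hN.meanCellArea_eq_lintegral hlam hB hB0 hB' i]
  have hmax (y : Plane) := hMP.tsum_measure_strictMax hlam (hsc y) (hfin y) (hA y)
    (fun x hx => hx.2.2)
  simp_rw [show ∀ y, {x | x.1 ∈ B ∧ x.2.1 = i ∧ N.score y x ≠ 0} = A y from fun _ => rfl, hmax]
  change (ENNReal.ofReal (p i))⁻¹ * ((ENNReal.ofReal lam * volume B)⁻¹ *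
    ∫⁻ y, ∫⁻ x in A y, expNeg (Λ {w | N.score y x ≤ N.score y w}) ∂Λ) = _
  simp_rw [hinner]
  have hjoint : Measurable fun q : Plane × Plane => φ (q.1 - q.2) :=
    hφ.comp (measurable_fst.sub measurable_snd)
  rw [lintegral_const_mul _ hjoint.lintegral_prod_right',
    lintegral_lintegral_swap hjoint.aemeasurable]
  have hshift (x : Plane) : ∫⁻ y, φ (y - x) = ∫⁻ z, φ z := lintegral_sub_right_eq_self φ x
  simp_rw [hshift]
  rw [setLIntegral_const]
  have h1 : ENNReal.ofReal (p i) ≠ 0 := by simpa using hi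
  have h2 : ENNReal.ofReal lam * volume B ≠ 0 := mul_ne_zero (by simpa using hlam) hB0
  have h3 : ENNReal.ofReal lam * volume B ≠ ∞ := ENNReal.mul_ne_top ENNReal.ofReal_ne_top hB'
  calc (ENNReal.ofReal (p i))⁻¹ * ((ENNReal.ofReal lam * volume B)⁻¹ *
        (ENNReal.ofReal lam * ENNReal.ofReal (p i) * ((∫⁻ z, φ z) * volume B)))
      = ((ENNReal.ofReal (p i))⁻¹ * ENNReal.ofReal (p i)) *
        ((ENNReal.ofReal lam * volume B)⁻¹ * (ENNReal.ofReal lam * volume B)) * ∫⁻ z, φ z := by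
        ring
    _ = ∫⁻ z, φ z := by
        rw [ENNReal.inv_mul_cancel h1 ENNReal.ofReal_ne_top, ENNReal.inv_mul_cancel h2 h3, one_mul,
          one_mul]

end HetNet.IsPoissonNetwork

end MeanCellArea

theorem lemma2 {Ω M : Type*} [MeasurableSpace Ω] [MeasurableSpace M] {K : ℕ}
    (P : Measure Ω) [IsProbabilityMeasure P] (N : HetNet Ω M K)
    (lam : ℝ) (hlam : 0 < lam) (p : Fin K → ℝ) (hp : ∀ k, 0 ≤ p k)
    (ν : Fin K → Measure M) [∀ k, IsProbabilityMeasure (ν k)]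
    (γ : Fin K → Measure ℝ≥0) [∀ k, IsProbabilityMeasure (γ k)]
    (hN : N.IsPoissonNetwork P lam p ν γ)
    (hpow : ∀ k, 0 < N.pow k) (hple : ∀ k, 0 < N.ple k)
    (hpos : ∀ k, ∀ᵐ h ∂(γ k), 0 < h)
    (hmom : ∀ k, Integrable (fun h : ℝ≥0 => (h : ℝ) ^ (2 / N.ple k)) (γ k))
    (i : Fin K) (hi : 0 < p i)
    (B : Set Plane) (hB : MeasurableSet B) (hB0 : volume B ≠ 0) (hBfin : volume B ≠ ∞)
    (lamt : Fin K → ℝ)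
    (hlamt : ∀ k, lamt k =
      (p k * lam) * (N.pow k : ℝ) ^ (2 / N.ple k) * gainMoment (γ k) (2 / N.ple k)) :
    IntegrableOn (fun r : ℝ => r * ∫ h : ℝ≥0, Real.exp (-(Real.pi *
        ∑ k, lamt k * r ^ (2 * N.ple i / N.ple k)
          * ((N.pow i : ℝ) * (h : ℝ)) ^ (-(2 / N.ple k)))) ∂(γ i)) (Ioi 0) ∧
    N.meanCellArea P lam B i =
      ENNReal.ofReal (2 * Real.pi * ∫ r in Ioi (0 : ℝ), r * ∫ h : ℝ≥0, Real.exp (-(Real.pi *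
        ∑ k, lamt k * r ^ (2 * N.ple i / N.ple k)
          * ((N.pow i : ℝ) * (h : ℝ)) ^ (-(2 / N.ple k)))) ∂(γ i)) ∧
    ∀ a : ℝ, (∀ k, N.ple k = a) →
      N.meanCellArea P lam B i =
        ENNReal.ofReal (((N.pow i : ℝ) ^ (2 / a) * gainMoment (γ i) (2 / a)) /
          ∑ k, (p k * lam) * (N.pow k : ℝ) ^ (2 / a) * gainMoment (γ k) (2 / a)) := by
  have hg (k : Fin K) : 0 < gainMoment (γ k) (2 / N.ple k) := gainMoment_pos (hpos k) (hmom k)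
  have hpw (k : Fin K) : (0 : ℝ) < N.pow k := hpow k
  have hlamt0 (k : Fin K) : 0 ≤ lamt k := by
    rw [hlamt]
    have := (hg k).le
    have := hp k
    positivity
  have hlamti : 0 < lamt i := by
    rw [hlamt]
    have := hg i
    have := hpw i
    positivity
  have harea := hN.meanCellArea_eq_lintegral_coverage hlam hp hpow hple hpos hmom hlamt i hi hB hB0
    hBfin
  have hfin := lintegral_coverage_ne_top N.ple (N.pow i) hlamt0 (hpw i) hlamti (hple i).ne' (hpos i)
    (hmom i)
  obtain ⟨hint, hpolar⟩ := integrableOn_and_lintegral_coverage N.ple (N.pow i) (N.ple i) hlamt0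
    (hpw i).le hfin
  refine ⟨hint, harea.trans hpolar, fun a ha => ?_⟩
  have hsum : 0 < ∑ k, lamt k :=
    Finset.sum_pos' (fun k _ => hlamt0 k) ⟨i, Finset.mem_univ i, hlamti⟩
  have hconst := lintegral_coverage_of_const N.ple (N.pow i) (N.ple i) (γ := γ i) (hpw i) hsum
    (hple i).ne' (fun k => (ha k).trans (ha i).symm) (hpos i) (hmom i)
  rw [harea, hconst]
  simp only [hlamt, ha]
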